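/- **Conventions.** A map $F:X\to Y$ of metric spaces is an $(a_1,a_2,k)$-rough quasi-isometric mapping ($a_2\ge a_1>0$, $k\ge 0$) if $\operatorname{dist}(y,F(X))\le k$ for all $y\in Y$ and $a_1d_X(x,x')-k\le d_Y(F(x),F(x'))\le a_2d_X(x,x')+k$ for all $x,x'\in X$; it is an $(a,k)$-rough similarity if $a_1=a_2=a$. A homeomorphism $f:Z\to W$ is $(\theta,\lambda)$-power quasi-symmetric ($\theta,\lambda\ge1$) if $\frac{d_W(f(x),f(z))}{d_W(f(y),f(z))}\le\eta\!\left(\frac{d_Z(x,z)}{d_Z(y,z)}\right)$ for all $x,y,z\in Z$ with $y\ne z$, where $\eta(t)=\lambda t^{1/\theta}$ for $t<1$ and $\eta(t)=\lambda t^{\theta}$ for $t\ge1$. A hyperbolic filling $X_Z$ of $Z$ with parameters $\alpha>1$ and $\tau>\max\{3,\alpha/(\alpha-1)\}$ is obtained by choosing for each $n\in\mathbb Z$ a maximal $\alpha^{-n}$-separated set $S_n\subset Z$: it is the metric graph with unit edges and its path metric $|\cdot|$, whose vertices are the pairs $v=(z,n)$ with $z\in S_n$ (with $\pi(v)=z$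 and height $h(v)=n$), two different vertices $v,w$ being joined by an edge if $|h(v)-h(w)|\le1$ and $B(\pi(v),\tau\alpha^{-h(v)})\cap B(\pi(w),\tau\alpha^{-h(w)})\ne\emptyset$; $h$ is extended affinely to the edges. A vertical line anchored at $z\in Z$ is an isometric embedding $\gamma_z:\mathbb R\to X_Z$ whose image lies in a union of edges with end points of different heights, with $h(\gamma_z(t))=t$ for all $t$, and $z\in B(\pi(v),\frac\tau3\alpha^{-h(v)})$ for every vertex $v$ on it. The infinite hyperbolic cone is $\mathrm{Con}_h(Z)=Z\times(0,\infty)$ with the metric $\rho_h((x,s),(y,t))=2\log\frac{d_Z(x,y)+\max\{s,t\}}{\sqrt{st}}$. For a family $(\gamma_z)_{z\in Z}$ of vertical lines $\gamma_z$ anchored at $z$, put $\sigma(z,s)=\gamma_z\!\left(-\frac{\log s}{\log\alpha}\right)$, so that $\sigma:\mathrm{Con}_h(Z)\to X_Z$. **Theorem 4.1.** Let $Z,W$ be complete metric spaces, let $X_Z$ (parameters $\alpha_Z,\tau_Z$) and $X_W$ (parameters $\alpha_W,\tau_W$) be hyperbolic fillings of them, and let $f:Z\to W$ be $(\theta,\lambda)$-power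 quasi-symmetric. Then there is a map $F_e:X_Z\to X_W$ which is an $(L_1,L_2,\Lambda)$-rough quasi-isometric mapping with $$L_1=\frac{\log\alpha_Z}{\theta\log\alpha_W},\qquad L_2=\frac{\theta\log\alpha_Z}{\log\alpha_W},\qquad \Lambda=\Lambda(\alpha_Z,\tau_Z,\alpha_W,\tau_W,\theta,\lambda).$$ More precisely, there are constants $C_\sigma,C_{\sigma^{-1}}$ depending only on the two parameters of a filling, constants $\mu,k$ depending only on $\theta,\lambda$, and $\Lambda$ as above, such that the following hold. 1. For every $z\in Z$ there is a vertical line in $X_Z$ anchored at $z$, and likewise for $X_W$. 2. There are nondecreasing continuous surjective functions $\Phi_z:\mathbb R\to\mathbb R$ ($z\in Z$), tending to $\pm\infty$ at $\pm\infty$ and $(1/\theta,\theta,\mu)$-rough quasi-isometric, with $\bigl|-\log_2 d_W(f(z),f(y))-\Phi_z(-\log_2 d_Z(z,y))\bigr|\le\mu$ for $z\ne y$ and $|\Phi_x(-\log_2t)-\Phi_y(-\log_2t)|\le\mu$ for $x\neq y$ and $t\ge d_Z(x,y)$, such that the cone extension $\hat f(z,t)=\bigl(f(z),2^{-\Phi_z(-\log_2t)}\bigr)$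 is a $(1/\theta,\theta,k)$-rough quasi-isometric mapping $\mathrm{Con}_h(Z)\to\mathrm{Con}_h(W)$ and such that 3 and 4 hold for every choice of the families of anchored vertical lines in $X_Z$ and $X_W$, with corresponding maps $\sigma$ and $\sigma'$. 3. $\sigma$ is a $(1/\log\alpha_Z,C_\sigma(\alpha_Z,\tau_Z))$-rough similarity and $\sigma'$ is a $(1/\log\alpha_W,C_\sigma(\alpha_W,\tau_W))$-rough similarity. There exist maps $\sigma^{-1}:X_Z\to\mathrm{Con}_h(Z)$ with $\sigma(\sigma^{-1}(x))=x$ for all $x\in\sigma(\mathrm{Con}_h(Z))$ and $|x-\sigma(\sigma^{-1}(x))|\le C_\sigma(\alpha_Z,\tau_Z)+1$ for all $x\in X_Z$. 4. For every map $\sigma^{-1}$ as in 3: $\sigma^{-1}$ is a $(\log\alpha_Z,C_{\sigma^{-1}}(\alpha_Z,\tau_Z))$-rough similarity and a rough inverse of $\sigma$ (that is, it is rough quasi-isometric and $\sigma\circ\sigma^{-1}$, $\sigma^{-1}\circ\sigma$ are at bounded distance from the identity maps), and $$F_e=\sigma'\circ\hat f\circ\sigma^{-1}:X_Z\to X_W$$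 is an $(L_1,L_2,\Lambda)$-rough quasi-isometric mapping. -/

import Mathlib

universe u v

/-! ### Rough quasi-isometries -/

section Rough

variable {X : Type u} {Y : Type v} [MetricSpace X] [MetricSpace Y]

/-- `f` is an `(a₁, a₂, k)`-rough quasi-isometric mapping: its image is `k`-cobounded in `Y`, and
distances are distorted by the factors `a₁`, `a₂` up to the additive constant `k`. The distance to
the image is taken in `[0, ∞]`, so that the empty set is at infinite distance from every point. -/
structure IsRoughQuasiIsometry (a₁ a₂ k : ℝ) (f : X → Y) : Prop where
  pos : 0 < a₁
  le : a₁ ≤ a₂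
  nonneg : 0 ≤ k
  cobounded : ∀ y : Y, Metric.infEDist y (Set.range f) ≤ ENNReal.ofReal k
  lower : ∀ x z : X, a₁ * dist x z - k ≤ dist (f x) (f z)
  upper : ∀ x z : X, dist (f x) (f z) ≤ a₂ * dist x z + k

/-- `(a, k)`-rough similarities. -/
def IsRoughSimilarity (a k : ℝ) (f : X → Y) : Prop :=
  IsRoughQuasiIsometry a a k f

/-- `g` is a rough inverse of `f`: it is a rough quasi-isometric mapping, and both compositions
are at bounded distance from the identity. -/
def IsRoughInverse (f : X → Y) (g : Y → X) : Prop :=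
  (∃ a₁ a₂ k : ℝ, IsRoughQuasiIsometry a₁ a₂ k g) ∧
  (∃ K : ℝ, ∀ x : X, dist (g (f x)) x ≤ K) ∧
  (∃ K : ℝ, ∀ y : Y, dist (f (g y)) y ≤ K)

/-- `g` picks a point of the fibre of `f` over every point of the image of `f`, and over every
other point `y` some point which `f` sends to within `C + 1` of `y`. -/
def IsRoughSection (C : ℝ) (f : X → Y) (g : Y → X) : Prop :=
  (∀ y ∈ Set.range f, f (g y) = y) ∧ ∀ y : Y, dist y (f (g y)) ≤ C + 1

end Rough

/-! ### Power quasi-symmetric mappings -/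

/-- The control function `t ↦ lam * t ^ (1/θ)` for `t < 1`, `t ↦ lam * t ^ θ` for `t ≥ 1`. -/
noncomputable def powerGauge (θ lam t : ℝ) : ℝ :=
  if t < 1 then lam * t ^ (1 / θ) else lam * t ^ θ

/-- `(θ, lam)`-power quasi-symmetric mappings. -/
structure IsPowerQuasiSymmetric {Z : Type u} {W : Type v} [MetricSpace Z] [MetricSpace W]
    (θ lam : ℝ) (f : Z → W) : Prop where
  one_le_exponent : 1 ≤ θ
  one_le_const : 1 ≤ lam
  isHomeomorph : IsHomeomorph f
  ratio_le : ∀ x y z : Z, y ≠ z →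
    dist (f x) (f z) / dist (f y) (f z) ≤ powerGauge θ lam (dist x z / dist y z)

/-! ### Metric graphs with unit edges -/

section Graph

variable {V : Type u}

/-- The geometric realization of a graph, in barycentric coordinates: its points are the vertices
and the points `(1 - t) v + t w` with `t ∈ [0, 1]` of the edges `[v, w]`. -/
def MetricGraph (G : SimpleGraph V) : Type u :=
  {x : V →₀ ℝ // ∃ (v w : V) (t : ℝ), (v = w ∨ G.Adj v w) ∧ 0 ≤ t ∧ t ≤ 1 ∧
    x = Finsupp.single v (1 - t) + Finsupp.single w t}

namespace MetricGraph

variable {G : SimpleGraph V}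

/-- A vertex as a point of the realization. -/
noncomputable def vertex (G : SimpleGraph V) (v : V) : MetricGraph G :=
  ⟨Finsupp.single v 1, v, v, 0, Or.inl rfl, le_refl 0, zero_le_one, by simp⟩

/-- The point at distance `t` from `v` on the edge `[v, w]`. -/
noncomputable def edgePoint {v w : V} (h : G.Adj v w) (t : Set.Icc (0 : ℝ) 1) : MetricGraph G :=
  ⟨Finsupp.single v (1 - (t : ℝ)) + Finsupp.single w (t : ℝ),
    v, w, t, Or.inr h, t.2.1, t.2.2, rfl⟩

/-- `PolygonalPath x y ℓ`: there is a piecewise linear path of length `ℓ` from `x` to `y`, that is,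
a finite concatenation of segments each of which lies in one edge. -/
inductive PolygonalPath : MetricGraph G → MetricGraph G → ℝ → Prop
  | nil (x : MetricGraph G) : PolygonalPath x x 0
  | cons {v w : V} (h : G.Adj v w) (s t : Set.Icc (0 : ℝ) 1) {y : MetricGraph G} {l : ℝ} :
      PolygonalPath (edgePoint h t) y l →
      PolygonalPath (edgePoint h s) y (|(s : ℝ) - t| + l)

/-- The path metric: the infimum of the lengths of the paths from `x` to `y`. -/
noncomputable def pathDist (x y : MetricGraph G) : ℝ :=
  sInf {l : ℝ | PolygonalPath x y l}

theorem PolygonalPath.trans {x y z : MetricGraph G} {l m : ℝ} (h₁ : PolygonalPath x y l)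
    (h₂ : PolygonalPath y z m) : PolygonalPath x z (l + m) := by
  induction h₁ with
  | nil x => simpa using h₂
  | cons h s t _ ih =>
    rw [add_assoc]
    exact PolygonalPath.cons h s t (ih h₂)

theorem PolygonalPath.symm {x y : MetricGraph G} {l : ℝ} (h₁ : PolygonalPath x y l) :
    PolygonalPath y x l := by
  induction h₁ with
  | nil x => exact PolygonalPath.nil x
  | cons h s t _ ih =>
    have := ih.trans (PolygonalPath.cons h t s (PolygonalPath.nil _))
    rwa [add_zero, abs_sub_comm, add_comm] at this

theorem PolygonalPath.nonneg {x y : MetricGraph G} {l : ℝ} (h₁ : PolygonalPath x y l) :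
    0 ≤ l := by
  induction h₁ with
  | nil x => exact le_refl 0
  | cons h s t _ ih => positivity

theorem PolygonalPath.coord_le {x y : MetricGraph G} {l : ℝ} (h₁ : PolygonalPath x y l) (a : V) :
    |x.1 a - y.1 a| ≤ l := by
  induction h₁ with
  | nil x => simp
  | @cons v w h s t y l _ ih =>
    have key : |(edgePoint h s).1 a - (edgePoint h t).1 a| ≤ |(s : ℝ) - t| := by
      classical
      have hne : v ≠ w := h.ne
      simp only [edgePoint, Finsupp.add_apply, Finsupp.single_apply]
      split_ifs with h1 h2 h2
      · exact absurd (h1.trans h2.symm) hne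
      · have : (1 - (s : ℝ) + 0) - (1 - (t : ℝ) + 0) = -((s : ℝ) - t) := by ring
        rw [this, abs_neg]
      · simp
      · simp
    exact (abs_sub_le _ _ _).trans (add_le_add key ih)

theorem eq_vertex_or_edgePoint (x : MetricGraph G) :
    (∃ v, x = vertex G v) ∨ ∃ (v w : V) (h : G.Adj v w) (t : Set.Icc (0 : ℝ) 1),
      x = edgePoint h t := by
  obtain ⟨x, v, w, t, h | h, h0, h1, rfl⟩ := x
  · subst h
    refine Or.inl ⟨v, Subtype.ext ?_⟩
    change Finsupp.single v (1 - t) + Finsupp.single v t = Finsupp.single v 1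
    rw [← Finsupp.single_add]
    simp
  · exact Or.inr ⟨v, w, h, ⟨t, h0, h1⟩, rfl⟩

theorem edgePoint_zero {v w : V} (h : G.Adj v w) :
    edgePoint h ⟨0, by simp⟩ = vertex G v :=
  Subtype.ext (by simp [edgePoint, vertex])

theorem edgePoint_one {v w : V} (h : G.Adj v w) :
    edgePoint h ⟨1, by simp⟩ = vertex G w :=
  Subtype.ext (by simp [edgePoint, vertex])

theorem exists_path_vertex (x : MetricGraph G) : ∃ v l, PolygonalPath x (vertex G v) l := by
  obtain ⟨v, rfl⟩ | ⟨v, w, h, t, rfl⟩ := eq_vertex_or_edgePoint x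
  · exact ⟨v, 0, PolygonalPath.nil _⟩
  · refine ⟨v, _, PolygonalPath.cons h t ⟨0, by simp⟩ (y := vertex G v) (l := 0) ?_⟩
    rw [edgePoint_zero h]
    exact PolygonalPath.nil _

theorem exists_path_of_walk {v w : V} (p : G.Walk v w) :
    ∃ l, PolygonalPath (vertex G v) (vertex G w) l := by
  induction p with
  | nil => exact ⟨0, PolygonalPath.nil _⟩
  | @cons a b c h p ih =>
    obtain ⟨l, hl⟩ := ih
    refine ⟨_, PolygonalPath.trans (l := |((⟨0, by simp⟩ : Set.Icc (0 : ℝ) 1) : ℝ) -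
      (⟨1, by simp⟩ : Set.Icc (0 : ℝ) 1)| + 0) ?_ hl⟩
    rw [← edgePoint_zero h, ← edgePoint_one h]
    exact PolygonalPath.cons h _ _ (PolygonalPath.nil _)

theorem exists_path (hG : G.Preconnected) (x y : MetricGraph G) : ∃ l, PolygonalPath x y l := by
  obtain ⟨v, l, hl⟩ := exists_path_vertex x
  obtain ⟨w, m, hm⟩ := exists_path_vertex y
  obtain ⟨p⟩ := hG v w
  obtain ⟨n, hn⟩ := exists_path_of_walk p
  exact ⟨_, (hl.trans hn).trans hm.symm⟩

theorem bddBelow_lengths (x y : MetricGraph G) : BddBelow {l : ℝ | PolygonalPath x y l} :=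
  ⟨0, fun _ h => h.nonneg⟩

/-- The realization of a connected graph is a metric space under the path metric. -/
noncomputable abbrev metricSpace (hG : G.Preconnected) : MetricSpace (MetricGraph G) where
  dist := pathDist
  dist_self x := le_antisymm (csInf_le (bddBelow_lengths x x) (PolygonalPath.nil x))
    (Real.sInf_nonneg fun _ h => h.nonneg)
  dist_comm x y := congrArg sInf (Set.ext fun _ => ⟨fun h => h.symm, fun h => h.symm⟩)
  dist_triangle x y z := by
    refine le_of_forall_pos_le_add fun ε hε => ?_
    obtain ⟨l, hl, hl'⟩ := Real.lt_sInf_add_pos (s := {l : ℝ | PolygonalPath x y l})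
      (exists_path hG x y) (half_pos hε)
    obtain ⟨m, hm, hm'⟩ := Real.lt_sInf_add_pos (s := {l : ℝ | PolygonalPath y z l})
      (exists_path hG y z) (half_pos hε)
    have := csInf_le (bddBelow_lengths x z) (PolygonalPath.trans hl hm)
    unfold pathDist
    linarith
  eq_of_dist_eq_zero {x y} h := by
    refine Subtype.ext (Finsupp.ext fun a => ?_)
    have h1 : |x.1 a - y.1 a| ≤ pathDist x y :=
      le_csInf (exists_path hG x y) fun l hl => hl.coord_le a
    have h2 : pathDist x y = 0 := h
    rw [h2] at h1
    exact sub_eq_zero.1 (abs_eq_zero.1 (le_antisymm h1 (abs_nonneg _)))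

/-- The affine extension along the edges of a function on the vertices. -/
noncomputable def extend (h : V → ℝ) (x : MetricGraph G) : ℝ :=
  x.1.sum fun v a => a * h v

end MetricGraph

end Graph

/-! ### Hyperbolic fillings -/

/-- The data of a hyperbolic filling of `Z` with construction parameters `α`, `τ`: for every
integer `n` a maximal `α ^ (-n)`-separated subset of `Z`. -/
structure HyperbolicFilling (Z : Type u) [MetricSpace Z] (α τ : ℝ) where
  one_lt : 1 < α
  max_lt : max 3 (α / (α - 1)) < τ
  net : ℤ → Set Z
  maximal_net : ∀ n : ℤ,
    Maximal (fun S : Set Z => S.Pairwise fun x y => α ^ (-n) ≤ dist x y) (net n)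

namespace HyperbolicFilling

variable {Z : Type u} [MetricSpace Z] {α τ : ℝ} (X : HyperbolicFilling Z α τ)

/-- The vertices are the pairs `(z, n)` with `z` in the `n`-th net. -/
def Vertex : Type u := {p : Z × ℤ // p.1 ∈ X.net p.2}

variable {X} in
/-- The projection of a vertex to `Z`. -/
def Vertex.proj (p : X.Vertex) : Z := p.1.1

variable {X} in
/-- The height of a vertex. -/
def Vertex.height (p : X.Vertex) : ℤ := p.1.2

/-- Two different vertices are neighbours if their heights differ by at most one and the balls
`B(z, τ α ^ (-n))` associated to them meet. -/
def graph : SimpleGraph X.Vertex where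
  Adj p q := p ≠ q ∧ |p.height - q.height| ≤ 1 ∧
    (Metric.ball p.proj (τ * α ^ (-p.height)) ∩
      Metric.ball q.proj (τ * α ^ (-q.height))).Nonempty
  symm := ⟨fun p q h => ⟨h.1.symm, by rw [abs_sub_comm]; exact h.2.1, by
    rw [Set.inter_comm]; exact h.2.2⟩⟩
  loopless := ⟨fun p h => h.1 rfl⟩

theorem exists_mem_net (z : Z) (n : ℤ) : ∃ s ∈ X.net n, dist z s < α ^ (-n) := by
  have hpos : 0 < α ^ (-n) := zpow_pos (zero_lt_one.trans X.one_lt) _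
  by_contra hcon
  push Not at hcon
  have hsep : (insert z (X.net n)).Pairwise fun x y => α ^ (-n) ≤ dist x y := by
    refine (X.maximal_net n).prop.insert fun y hy _ => ⟨hcon y hy, ?_⟩
    rw [dist_comm]
    exact hcon y hy
  have hz : z ∈ X.net n :=
    (X.maximal_net n).le_of_ge hsep (Set.subset_insert _ _) (Set.mem_insert _ _)
  have := hcon z hz
  rw [dist_self] at this
  linarith

theorem reachable_of_mem {p q : X.Vertex} (z : Z) (h : |p.height - q.height| ≤ 1)
    (hp : dist z p.proj < τ * α ^ (-p.height)) (hq : dist z q.proj < τ * α ^ (-q.height)) :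
    X.graph.Reachable p q := by
  by_cases hpq : p = q
  · rw [hpq]
  · exact SimpleGraph.Adj.reachable ⟨hpq, h, z, hp, hq⟩

theorem preconnected : X.graph.Preconnected := by
  have hα : 0 < α := zero_lt_one.trans X.one_lt
  have hτ : 3 < τ := (le_max_left _ _).trans_lt X.max_lt
  have hpow : ∀ n : ℤ, 0 < α ^ n := fun n => zpow_pos hα n
  choose s hs hd using X.exists_mem_net
  let vert : Z → ℤ → X.Vertex := fun z n => ⟨(z, n).map (fun z => s z n) id, hs z n⟩
  have hd' : ∀ z n, dist z (vert z n).proj < τ * α ^ (-n) := fun z n =>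
    (hd z n).trans (by nlinarith [hpow (-n)])
  have hup : ∀ z n, X.graph.Reachable (vert z n) (vert z (n + 1)) := fun z n =>
    X.reachable_of_mem z (by
      change |n - (n + 1)| ≤ 1
      simp) (hd' z n) (hd' z (n + 1))
  have hray : ∀ z (n : ℤ) (k : ℕ), X.graph.Reachable (vert z n) (vert z (n + k)) := by
    intro z n k
    induction k with
    | zero => simp
    | succ k ih =>
      have := ih.trans (hup z (n + k))
      rwa [add_assoc] at this
  have hline : ∀ z (m n : ℤ), m ≤ n → X.graph.Reachable (vert z m) (vert z n) := by
    intro z m n h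
    have := hray z m (n - m).toNat
    rwa [Int.toNat_of_nonneg (by omega), add_sub_cancel] at this
  have hself : ∀ p : X.Vertex, X.graph.Reachable p (vert p.proj p.height) := fun p =>
    X.reachable_of_mem p.proj (by
      change |p.height - p.height| ≤ 1
      simp) (by
      rw [dist_self]
      have := hpow (-p.height)
      positivity) (hd' _ _)
  intro p q
  obtain ⟨N, hN⟩ := pow_unbounded_of_one_lt (dist p.proj q.proj) X.one_lt
  obtain ⟨m, hm⟩ : ∃ m : ℤ, m = min (-(N : ℤ)) (min p.height q.height) := ⟨_, rfl⟩
  have hm' : dist p.proj q.proj < α ^ (-m) := by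
    refine hN.trans_le ?_
    rw [← zpow_natCast]
    exact zpow_le_zpow_right₀ X.one_lt.le (by omega)
  have hpq : X.graph.Reachable (vert p.proj m) (vert q.proj m) := by
    refine X.reachable_of_mem p.proj ?_ (hd' _ _) ?_
    · change |m - m| ≤ 1
      simp
    · have h1 := dist_triangle p.proj q.proj (vert q.proj m).proj
      have h2 : dist q.proj (vert q.proj m).proj < α ^ (-m) := hd _ _
      change _ < τ * α ^ (-m)
      nlinarith [hpow (-m)]
  exact ((hself p).trans (hline p.proj m p.height (by omega)).symm).trans
    (hpq.trans ((hline q.proj m q.height (by omega)).trans (hself q).symm))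

/-- The hyperbolic filling as a metric graph with edges of length one. -/
def Space : Type u := MetricGraph X.graph

noncomputable instance : MetricSpace X.Space := MetricGraph.metricSpace X.preconnected

/-- The height function, extended affinely along the edges. -/
noncomputable def height (x : X.Space) : ℝ :=
  MetricGraph.extend (fun p : X.Vertex => (p.height : ℝ)) x

/-- `γ` is a vertical geodesic line anchored at `z` and parametrized by height: it is an isometric
embedding of the line, runs in edges whose end points have different heights, and
`z ∈ B(π(p), (τ / 3) α ^ (-h(p)))` for every vertex `p` on it. -/
structure IsAnchoredLine (z : Z) (γ : ℝ → X.Space) : Prop where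
  isometry : Isometry γ
  vertical : ∀ t : ℝ, ∃ (p q : X.Vertex) (h : X.graph.Adj p q) (s : Set.Icc (0 : ℝ) 1),
    p.height ≠ q.height ∧ γ t = MetricGraph.edgePoint h s
  anchored : ∀ p : X.Vertex, MetricGraph.vertex X.graph p ∈ Set.range γ →
    z ∈ Metric.ball p.proj (τ / 3 * α ^ (-p.height))
  height_eq : ∀ t : ℝ, X.height (γ t) = t

end HyperbolicFilling

/-! ### Infinite hyperbolic cones -/

/-- The infinite hyperbolic cone `Z × (0, ∞)`. -/
@[ext] structure HypCone (Z : Type u) where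
  base : Z
  level : ℝ
  level_pos : 0 < level

namespace HypCone

variable {Z : Type u} [MetricSpace Z]

/-- `ρ((x, s), (y, t)) = 2 log ((d(x, y) + max s t) / √(s t))`. -/
noncomputable def rho (p q : HypCone Z) : ℝ :=
  2 * Real.log ((dist p.base q.base + max p.level q.level) / √(p.level * q.level))

theorem rho_eq (p q : HypCone Z) : rho p q =
    2 * Real.log (dist p.base q.base + max p.level q.level) -
      Real.log p.level - Real.log q.level := by
  have hp := p.level_pos
  have hq := q.level_pos
  have h1 : 0 < dist p.base q.base + max p.level q.level :=
    add_pos_of_nonneg_of_pos dist_nonneg (lt_max_of_lt_left hp)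
  rw [rho, Real.log_div h1.ne' (Real.sqrt_pos.2 (mul_pos hp hq)).ne',
    Real.log_sqrt (mul_pos hp hq).le, Real.log_mul hp.ne' hq.ne']
  ring

noncomputable instance : MetricSpace (HypCone Z) where
  dist := rho
  dist_self p := by
    rw [rho_eq, dist_self, max_self, zero_add]
    ring
  dist_comm p q := by
    rw [rho_eq, rho_eq, dist_comm, max_comm]
    ring
  dist_triangle p q r := by
    rw [rho_eq, rho_eq, rho_eq]
    have hp := p.level_pos
    have hq := q.level_pos
    have hr := r.level_pos
    have hpq : 0 < dist p.base q.base + max p.level q.level :=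
      add_pos_of_nonneg_of_pos dist_nonneg (lt_max_of_lt_left hp)
    have hqr : 0 < dist q.base r.base + max q.level r.level :=
      add_pos_of_nonneg_of_pos dist_nonneg (lt_max_of_lt_left hq)
    have hpr : 0 < dist p.base r.base + max p.level r.level :=
      add_pos_of_nonneg_of_pos dist_nonneg (lt_max_of_lt_left hp)
    have key : (dist p.base r.base + max p.level r.level) * q.level ≤
        (dist p.base q.base + max p.level q.level) *
          (dist q.base r.base + max q.level r.level) := by
      have ht := dist_triangle p.base q.base r.base
      have ha : 0 ≤ dist p.base q.base := dist_nonneg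
      have hb : 0 ≤ dist q.base r.base := dist_nonneg
      have hS : max p.level r.level * q.level ≤
          max p.level q.level * max q.level r.level := by
        rcases le_total p.level r.level with h | h
        · rw [max_eq_right h, mul_comm]
          exact mul_le_mul (le_max_right _ _) (le_max_right _ _) hr.le
            (hq.le.trans (le_max_right _ _))
        · rw [max_eq_left h]
          exact mul_le_mul (le_max_left _ _) (le_max_left _ _) hq.le
            (hp.le.trans (le_max_left _ _))
      have h1 : dist p.base q.base * q.level ≤ dist p.base q.base * max q.level r.level :=
        mul_le_mul_of_nonneg_left (le_max_left _ _) ha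
      have h2 : dist q.base r.base * q.level ≤ dist q.base r.base * max p.level q.level :=
        mul_le_mul_of_nonneg_left (le_max_right _ _) hb
      nlinarith [mul_nonneg ha hb, mul_le_mul_of_nonneg_right ht hq.le]
    have hlog := Real.log_le_log (mul_pos hpr hq) key
    rw [Real.log_mul hpr.ne' hq.ne', Real.log_mul hpq.ne' hqr.ne'] at hlog
    linarith
  eq_of_dist_eq_zero {p q} h := by
    have h' : rho p q = 0 := h
    rw [rho_eq] at h'
    have hp := p.level_pos
    have hq := q.level_pos
    have hm : 0 < max p.level q.level := lt_max_of_lt_left hp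
    have hd : 0 ≤ dist p.base q.base := dist_nonneg
    have e1 : Real.log (max p.level q.level) ≤
        Real.log (dist p.base q.base + max p.level q.level) :=
      Real.log_le_log hm (by linarith)
    have e2 := Real.log_le_log hp (le_max_left p.level q.level)
    have e3 := Real.log_le_log hq (le_max_right p.level q.level)
    have f1 : Real.log (max p.level q.level) =
        Real.log (dist p.base q.base + max p.level q.level) := by linarith
    have f2 : Real.log p.level = Real.log q.level := by linarith
    have g1 := Real.log_injOn_pos (Set.mem_Ioi.2 hm)
      (Set.mem_Ioi.2 (by linarith : 0 < dist p.base q.base + max p.level q.level)) f1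
    have g2 := Real.log_injOn_pos (Set.mem_Ioi.2 hp) (Set.mem_Ioi.2 hq) f2
    exact HypCone.ext (dist_eq_zero.1 (by linarith)) g2

end HypCone

/-! ### The maps between the cones and the fillings -/

/-- The map `σ` from the cone to the filling given by a family of vertical lines:
`σ(z, s) = γ_z(- log s / log α)`. -/
noncomputable def coneToFilling {Z : Type u} [MetricSpace Z] {α τ : ℝ}
    (X : HyperbolicFilling Z α τ) (γ : Z → ℝ → X.Space) (p : HypCone Z) : X.Space :=
  γ p.base (-(Real.log p.level / Real.log α))

/-- The cone map `(z, t) ↦ (f(z), 2 ^ (-Φ_z(-log₂ t)))`. -/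
noncomputable def coneMap {Z : Type u} {W : Type v} (f : Z → W) (Φ : Z → ℝ → ℝ)
    (p : HypCone Z) : HypCone W where
  base := f p.base
  level := (2 : ℝ) ^ (-Φ p.base (-Real.logb 2 p.level))
  level_pos := Real.rpow_pos_of_pos two_pos _

/-- `Φ` is a family of scale functions for `f`, with exponent `θ` and constant `μ`: every `Φ_z` is
a nondecreasing continuous `(1/θ, θ, μ)`-rough quasi-isometric map of the line onto itself,
`Φ_z` sends the scale `-log₂ d(z, y)` to the scale `-log₂ d(f(z), f(y))` up to `μ`, and
`Φ_x`, `Φ_y` agree up to `μ` at the scales `t ≥ d(x, y)`. -/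
structure IsScaleFamily {Z : Type u} {W : Type v} [MetricSpace Z] [MetricSpace W]
    (θ μ : ℝ) (f : Z → W) (Φ : Z → ℝ → ℝ) : Prop where
  monotone : ∀ z : Z, Monotone (Φ z)
  continuous : ∀ z : Z, Continuous (Φ z)
  tendsto_atBot : ∀ z : Z, Filter.Tendsto (Φ z) Filter.atBot Filter.atBot
  tendsto_atTop : ∀ z : Z, Filter.Tendsto (Φ z) Filter.atTop Filter.atTop
  surjective : ∀ z : Z, Function.Surjective (Φ z)
  rough : ∀ z : Z, IsRoughQuasiIsometry (1 / θ) θ μ (Φ z)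
  scale : ∀ z y : Z, z ≠ y →
    |-Real.logb 2 (dist (f z) (f y)) - Φ z (-Real.logb 2 (dist z y))| ≤ μ
  compare : ∀ x y : Z, x ≠ y → ∀ t : ℝ, dist x y ≤ t →
    |Φ x (-Real.logb 2 t) - Φ y (-Real.logb 2 t)| ≤ μ

/-!
The extension is a composition of three maps, and each of them is compared with the explicit metric
`ρ` of the hyperbolic cone, up to additive constants.

*The filling is roughly similar to the cone.* Two points at heights `u` and `v` on lines anchored at
`x` and `y` can be joined by descending to the height `n ≈ -log_α (d(x, y) + max α⁻ᵘ α⁻ᵛ)`, where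
the two lines pass through equal or adjacent vertices; this gives the upper bound of the distance
(`HyperbolicFilling.dist_le_of_common_level`). For the lower bound, an edge at height `m` moves the
projection to `Z` by at most a multiple of `α⁻ᵐ`, and a walk of length `ℓ` from height `h` to height
`h'` cannot get lower than `(h + h' - ℓ) / 2`. Summing a geometric series, the displacement is at
most a multiple of `α ^ ((ℓ - h - h') / 2)` (`HyperbolicFilling.dist_proj_add_le`). In the metric
graph, path lengths are bounded below because a function on the vertices that changes by at most one
along edges extends to a `1`-Lipschitz function (`MetricGraph.abs_extend_sub_le`).

*The scale functions.* In logarithmic coordinates, power quasi-symmetry says that the scales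
`a_y = -log₂ d(z, y)` and `A_y = -log₂ d(f(z), f(y))` satisfy `A_y - A_x ≤ g(a_y - a_x) + log₂ λ`,
where `g(u) = max (θ u) (u / θ)` is sublinear. Therefore the McShane-type extension
`Φ_z(s) = inf_y (A_y + g(s - a_y))` takes the value `A_y` at `a_y` up to `log₂ λ`, and it is
increasing and bi-Lipschitz with constants `1 / θ` and `θ`. At scales coarser than `d(x, y)` the
functions `Φ_x` and `Φ_y` agree up to a constant (`IsPowerQuasiSymmetric.scaleMap_le_add`).

*The cone map.* Up to a constant, the distance of two points of the cone with scales `p`, `q` over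
`x ≠ y` is `log 2 * (p + q - 2 m)`, where `m` is the minimum of `p`, `q` and `-log₂ d(x, y)`. As
`Φ_x` is monotone, it carries `m` to the corresponding minimum in the target
(`IsScaleFamily.abs_meet_sub_le`), and the bounds for `Φ` give the bounds for the cone map.
-/

universe w

/-! ### Lipschitz functions on metric graphs -/

namespace MetricGraph

variable {V : Type u} {G : SimpleGraph V}

theorem extend_edgePoint (h : V → ℝ) {v w : V} (e : G.Adj v w) (t : Set.Icc (0 : ℝ) 1) :
    extend h (edgePoint e t) = (1 - (t : ℝ)) * h v + (t : ℝ) * h w := by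
  classical
  change (Finsupp.single v (1 - (t : ℝ)) + Finsupp.single w (t : ℝ)).sum (fun v a => a * h v) = _
  rw [Finsupp.sum_add_index' (by simp) (by intros; ring), Finsupp.sum_single_index (by simp),
    Finsupp.sum_single_index (by simp)]

theorem extend_vertex (h : V → ℝ) (v : V) : extend h (vertex G v) = h v := by
  change (Finsupp.single v (1 : ℝ)).sum (fun v a => a * h v) = _
  rw [Finsupp.sum_single_index (by simp), one_mul]

/-- The affine extension of a function which changes by at most one along every edge is
`1`-Lipschitz. Applied to the height and to the combinatorial distance, this bounds the path metric
from below. -/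
theorem abs_extend_sub_le (hG : G.Preconnected) {h : V → ℝ}
    (hh : ∀ v w, G.Adj v w → |h v - h w| ≤ 1) (x y : MetricGraph G) :
    |extend h x - extend h y| ≤ pathDist x y := by
  refine le_csInf (exists_path hG x y) fun l hl => ?_
  induction hl with
  | nil x => simp
  | @cons v w e s t y l _ ih =>
    refine (abs_sub_le _ (extend h (edgePoint e t)) _).trans (add_le_add ?_ ih)
    rw [extend_edgePoint, extend_edgePoint]
    have : (1 - (s : ℝ)) * h v + s * h w - ((1 - (t : ℝ)) * h v + t * h w) =
        -(((s : ℝ) - t) * (h v - h w)) := by ring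
    rw [this, abs_neg, abs_mul]
    exact mul_le_of_le_one_right (abs_nonneg _) (hh v w e)

theorem pathDist_edgePoint_le {v w : V} (e : G.Adj v w) (s t : Set.Icc (0 : ℝ) 1) :
    pathDist (edgePoint e s) (edgePoint e t) ≤ |(s : ℝ) - t| := by
  refine csInf_le (bddBelow_lengths _ _) ?_
  have := PolygonalPath.cons e s t (PolygonalPath.nil _)
  rwa [add_zero] at this

theorem pathDist_vertex_le_of_adj {v w : V} (e : G.Adj v w) :
    pathDist (vertex G v) (vertex G w) ≤ 1 := by
  have := pathDist_edgePoint_le e ⟨0, by simp⟩ ⟨1, by simp⟩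
  rw [edgePoint_zero, edgePoint_one] at this
  simpa using this

theorem exists_pathDist_vertex_le_one (hG : G.Preconnected) (x : MetricGraph G) :
    ∃ v, pathDist x (vertex G v) ≤ 1 := by
  let _ := metricSpace hG
  obtain ⟨v, rfl⟩ | ⟨v, w, e, t, rfl⟩ := eq_vertex_or_edgePoint x
  · refine ⟨v, ?_⟩
    change dist (vertex G v) (vertex G v) ≤ 1
    simp
  · refine ⟨v, ?_⟩
    have := pathDist_edgePoint_le e t ⟨0, by simp⟩
    rw [edgePoint_zero] at this
    have h0 := t.2.1
    have h1 := t.2.2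
    refine this.trans ?_
    simp only [sub_zero]
    rw [abs_of_nonneg h0]
    exact h1

/-- The path metric of the realization dominates the combinatorial distance of the vertices, as the
affine extension of the latter is `1`-Lipschitz. -/
theorem natDist_le_pathDist (hG : G.Preconnected) (v w : V) :
    (G.dist v w : ℝ) ≤ pathDist (vertex G v) (vertex G w) := by
  have key : ∀ a b, G.Adj a b → (G.dist v a : ℝ) ≤ G.dist v b + 1 := by
    intro a b e
    obtain ⟨p, hp⟩ := (hG v b).exists_walk_length_eq_dist
    have := SimpleGraph.dist_le (p.concat e.symm)
    rw [SimpleGraph.Walk.length_concat, hp] at this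
    exact_mod_cast this
  have := abs_extend_sub_le hG (h := fun a => (G.dist v a : ℝ)) (fun a b e => by
    rw [abs_le]
    constructor <;> linarith [key a b e, key b a e.symm]) (vertex G v) (vertex G w)
  rw [extend_vertex, extend_vertex, SimpleGraph.dist_self] at this
  simpa using this

theorem vertex_eq_edgePoint {p v w : V} (e : G.Adj v w) (t : Set.Icc (0 : ℝ) 1)
    (h : vertex G p = edgePoint e t) : p = v ∨ p = w := by
  classical
  by_contra hcon
  push Not at hcon
  have h1 := congrArg (fun x : MetricGraph G => x.1 p) h
  simp [vertex, edgePoint, hcon.1.symm, hcon.2.symm] at h1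

end MetricGraph

namespace HyperbolicFilling

open MetricGraph

variable {Z : Type u} [MetricSpace Z] {α τ : ℝ}

theorem pos_base (X : HyperbolicFilling Z α τ) : 0 < α := zero_lt_one.trans X.one_lt

variable (X : HyperbolicFilling Z α τ)

theorem abs_height_sub_le (x y : X.Space) : |X.height x - X.height y| ≤ dist x y :=
  abs_extend_sub_le X.preconnected (fun p q h => by exact_mod_cast h.2.1) x y

/-- A vertex as a point of the filling. -/
noncomputable def point (p : X.Vertex) : X.Space := MetricGraph.vertex X.graph p

theorem height_point (p : X.Vertex) : X.height (X.point p) = p.height :=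
  extend_vertex _ _

theorem dist_point_le_one {p q : X.Vertex} (z : Z) (h : |p.height - q.height| ≤ 1)
    (hp : dist z p.proj < τ * α ^ (-p.height)) (hq : dist z q.proj < τ * α ^ (-q.height)) :
    dist (X.point p) (X.point q) ≤ 1 := by
  by_cases hpq : p = q
  · rw [hpq, dist_self]
    exact zero_le_one
  · exact pathDist_vertex_le_of_adj (G := X.graph) ⟨hpq, h, z, hp, hq⟩

/-! ### Vertical lines -/

/-- The line runs through net points `s n` with `d(z, s n) < α⁻ⁿ`, in affine parametrization; it is
an isometric embedding because its height is its parameter and the height is `1`-Lipschitz. -/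
theorem exists_isAnchoredLine (z : Z) : ∃ γ : ℝ → X.Space, X.IsAnchoredLine z γ := by
  have hτ : 3 < τ := (le_max_left _ _).trans_lt X.max_lt
  choose s hs hd using X.exists_mem_net z
  let q : ℤ → X.Vertex := fun n => ⟨(s n, n), hs n⟩
  have hq : ∀ n, (q n).height = n := fun n => rfl
  have hlt : ∀ n, dist z (q n).proj < τ / 3 * α ^ (-(q n).height) := fun n =>
    (hd n).trans (by change _ < τ / 3 * α ^ (-n); nlinarith [zpow_pos X.pos_base (-n)])
  have hlt' : ∀ n, dist z (q n).proj < τ * α ^ (-(q n).height) := fun n =>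
    (hlt n).trans (by nlinarith [zpow_pos X.pos_base (-(q n).height)])
  have hadj : ∀ n, X.graph.Adj (q n) (q (n + 1)) := fun n => by
    refine ⟨fun h => ?_, ?_, z, hlt' n, hlt' (n + 1)⟩
    · have := congrArg Vertex.height h
      rw [hq, hq] at this
      omega
    · rw [hq, hq]
      simp
  let γ : ℝ → X.Space := fun t =>
    edgePoint (hadj ⌊t⌋) ⟨Int.fract t, Int.fract_nonneg t, (Int.fract_lt_one t).le⟩
  -- on closed unit intervals: at `t = n + 1` the point is also the end of the edge below
  have hγ : ∀ (n : ℤ) (t : ℝ) (h0 : (n : ℝ) ≤ t) (h1 : t ≤ n + 1),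
      γ t = edgePoint (hadj n) ⟨t - n, by linarith, by linarith⟩ := by
    intro n t h0 h1
    rcases h1.lt_or_eq with h1 | h1
    · have hf : ⌊t⌋ = n := Int.floor_eq_iff.2 ⟨h0, h1⟩
      subst hf
      rfl
    · have ht : t = ((n + 1 : ℤ) : ℝ) := by push_cast; exact h1
      subst ht
      have e1 : (⟨((n + 1 : ℤ) : ℝ) - n, by linarith, by linarith⟩ : Set.Icc (0 : ℝ) 1) =
          ⟨1, by simp⟩ := Subtype.ext (by push_cast; ring)
      rw [e1, edgePoint_one]
      have e2 : ∀ m : ℤ, m = n + 1 → ∀ c : Set.Icc (0 : ℝ) 1, (c : ℝ) = 0 →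
          (edgePoint (hadj m) c) = vertex X.graph (q (n + 1)) := by
        rintro m rfl ⟨c, hc⟩ rfl
        exact edgePoint_zero _
      exact e2 _ (Int.floor_intCast _) _ (Int.fract_intCast _)
  have hlocal : ∀ (n : ℤ) (s t : ℝ), (n : ℝ) ≤ s → s ≤ t → t ≤ n + 1 →
      dist (γ s) (γ t) ≤ t - s := by
    intro n s t h0 hst h1
    rw [hγ n s h0 (hst.trans h1), hγ n t (h0.trans hst) h1]
    refine (pathDist_edgePoint_le (hadj n) _ _).trans (le_of_eq ?_)
    rw [abs_sub_comm, abs_of_nonneg (by simpa using hst)]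
    simp
  have hint : ∀ (n : ℤ) (k : ℕ), dist (γ n) (γ (n + k)) ≤ k := by
    intro n k
    induction k with
    | zero => simp
    | succ k ih =>
      have h1 := hlocal (n + k) (n + k) (n + k + 1) (by push_cast; exact le_rfl) (by linarith)
        (by push_cast; exact le_rfl)
      have h2 := dist_triangle (γ n) (γ (n + k)) (γ (n + k + 1))
      push_cast
      rw [← add_assoc]
      linarith
  have hle : ∀ s t : ℝ, s ≤ t → dist (γ s) (γ t) ≤ t - s := by
    intro s t hst
    by_cases h : t ≤ ⌊s⌋ + 1
    · exact hlocal ⌊s⌋ s t (Int.floor_le s) hst h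
    · push Not at h
      have hn : ⌊s⌋ + 1 ≤ ⌊t⌋ := Int.le_floor.2 (by push_cast; exact h.le)
      obtain ⟨k, hk⟩ := Int.le.dest hn
      have hk' : ((⌊s⌋ + 1 : ℤ) : ℝ) + k = ⌊t⌋ := by exact_mod_cast hk
      have h1 := hlocal ⌊s⌋ s (⌊s⌋ + 1 : ℤ) (Int.floor_le s)
        (by push_cast; exact (Int.lt_floor_add_one s).le) (by push_cast; exact le_rfl)
      have h2 := hint (⌊s⌋ + 1) k
      rw [hk'] at h2
      have h3 := hlocal ⌊t⌋ ⌊t⌋ t le_rfl (Int.floor_le t) (Int.lt_floor_add_one t).le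
      have h4 := dist_triangle4 (γ s) (γ (⌊s⌋ + 1 : ℤ)) (γ ⌊t⌋) (γ t)
      linarith
  have hheight : ∀ t, X.height (γ t) = t := by
    intro t
    refine (extend_edgePoint _ (hadj ⌊t⌋) _).trans ?_
    simp only [hq]
    push_cast
    linarith [Int.floor_add_fract t]
  refine ⟨γ, ?_, ?_, ?_, hheight⟩
  · refine Isometry.of_dist_eq fun s t => le_antisymm ?_ ?_
    · rcases le_total s t with h | h
      · rw [dist_comm s t, Real.dist_eq, abs_of_nonneg (sub_nonneg.2 h)]
        exact hle s t h
      · rw [dist_comm (γ s), Real.dist_eq, abs_of_nonneg (sub_nonneg.2 h)]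
        exact hle t s h
    · have := X.abs_height_sub_le (γ s) (γ t)
      rwa [hheight, hheight] at this
  · exact fun t => ⟨_, _, hadj ⌊t⌋, _, by rw [hq, hq]; omega, rfl⟩
  · rintro p ⟨t, ht⟩
    rcases vertex_eq_edgePoint (hadj ⌊t⌋) _ ht.symm with rfl | rfl
    · exact hlt _
    · exact hlt _

variable {X} in
/-- At integer times an anchored line passes through vertices, since its edges are vertical. -/
theorem IsAnchoredLine.exists_vertex {z : Z} {γ : ℝ → X.Space} (hγ : X.IsAnchoredLine z γ)
    (n : ℤ) : ∃ p : X.Vertex, γ n = X.point p ∧ p.height = n ∧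
      dist z p.proj < τ / 3 * α ^ (-n) := by
  have key : ∃ p : X.Vertex, γ n = X.point p := by
    obtain ⟨p, q, e, s, hpq, hs⟩ := hγ.vertical n
    have hh := hγ.height_eq n
    rw [hs] at hh
    have hh' := (extend_edgePoint (fun p : X.Vertex => (p.height : ℝ)) e s).symm.trans hh
    have h1 : p.height - q.height = 1 ∨ p.height - q.height = -1 := by
      have := abs_le.1 e.2.1
      omega
    have h0 := s.2.1
    have h2 := s.2.2
    -- the height `n` is an integer, so the barycentric coordinate is `0` or `1`
    obtain ⟨m, hm⟩ : ∃ m : ℤ, (s : ℝ) = m := by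
      rcases h1 with h1 | h1
      · have : (p.height : ℝ) - q.height = 1 := by exact_mod_cast h1
        refine ⟨p.height - n, ?_⟩
        push_cast
        have e3 : (q.height : ℝ) = p.height - 1 := by linarith
        rw [e3] at hh'
        linarith
      · have : (p.height : ℝ) - q.height = -1 := by exact_mod_cast h1
        refine ⟨n - p.height, ?_⟩
        push_cast
        have e3 : (q.height : ℝ) = p.height + 1 := by linarith
        rw [e3] at hh'
        linarith
    obtain ⟨s, hs0⟩ := s
    simp only at hm h0 h2
    subst hm
    have hm : m = 0 ∨ m = 1 := by
      have a1 : 0 ≤ m := by exact_mod_cast h0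
      have a2 : m ≤ 1 := by exact_mod_cast h2
      omega
    rcases hm with rfl | rfl
    · refine ⟨p, hs.trans ?_⟩
      rw [point, ← edgePoint_zero e]
      congr 2
      simp
    · refine ⟨q, hs.trans ?_⟩
      rw [point, ← edgePoint_one e]
      congr 2
      simp
  obtain ⟨p, hp⟩ := key
  have hn : p.height = n := by
    have := hγ.height_eq n
    rw [hp, height_point] at this
    exact_mod_cast this
  refine ⟨p, hp, hn, ?_⟩
  have := hγ.anchored p ⟨n, hp⟩
  rw [hn] at this
  exact this

end HyperbolicFilling

/-! ### Comparison of the filling with the cone -/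

namespace HyperbolicFilling

open MetricGraph

/-- The constant `B` in `dist_proj_add_le`. -/
noncomputable def heightConst (α τ : ℝ) : ℝ := τ * (1 + α) / (α - 1)

/-- The constant `K` in `dist_proj_add_le`. -/
noncomputable def walkConst (α τ : ℝ) : ℝ :=
  (τ * (1 + α) + heightConst α τ) / (1 - α ^ (-(1 / 2) : ℝ))

variable {Z : Type u} [MetricSpace Z] {α τ : ℝ} (X : HyperbolicFilling Z α τ)

theorem three_lt (X : HyperbolicFilling Z α τ) : 3 < τ := (le_max_left _ _).trans_lt X.max_lt

variable {X} in
theorem Vertex.abs_height_sub_le_one {p q : X.Vertex} (e : X.graph.Adj p q) :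
    |(p.height : ℝ) - q.height| ≤ 1 := by
  exact_mod_cast e.2.1

theorem abs_height_sub_le_length {p q : X.Vertex} (w : X.graph.Walk p q) :
    |(p.height : ℝ) - q.height| ≤ w.length := by
  induction w with
  | nil => simp
  | @cons a c b e w ih =>
    have h1 := Vertex.abs_height_sub_le_one e
    have h2 := abs_sub_le (a.height : ℝ) c.height b.height
    push_cast [SimpleGraph.Walk.length_cons]
    linarith

/-- A walk of length `ℓ` from `p` to `q` moves the projection to `Z` by at most a multiple of
`α ^ ((ℓ - h(p) - h(q)) / 2)`: it pays for a large displacement by descending. The term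
`B α ^ (-h(p))` makes the induction on the walk close: it absorbs the displacement along a
descending first edge. -/
theorem dist_proj_add_le {p q : X.Vertex} (w : X.graph.Walk p q) :
    dist p.proj q.proj + heightConst α τ * α ^ (-(p.height : ℝ)) ≤
      walkConst α τ * α ^ (((w.length : ℝ) - p.height - q.height) / 2) := by
  have hα := X.one_lt
  have hα0 := X.pos_base
  have hτ := X.three_lt
  have hB : 0 < heightConst α τ := by
    rw [heightConst]
    have : 0 < α - 1 := by linarith
    positivity
  have hBα : heightConst α τ * (α - 1) = τ * (1 + α) := by
    rw [heightConst, div_mul_cancel₀]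
    linarith
  set r : ℝ := α ^ (-(1 / 2) : ℝ) with hr
  have hr0 : 0 < r := Real.rpow_pos_of_pos hα0 _
  have hr1 : r < 1 := Real.rpow_lt_one_of_one_lt_of_neg hα (by norm_num)
  have hr2 : r * r * α = 1 := by
    rw [hr, ← Real.rpow_add hα0, ← Real.rpow_add_one hα0.ne']
    norm_num
  have hK : walkConst α τ * (1 - r) = τ * (1 + α) + heightConst α τ := by
    rw [walkConst, div_mul_cancel₀]
    linarith
  have hT : 0 < τ * (1 + α) := by positivity
  have hKB : heightConst α τ ≤ walkConst α τ := by
    have hK0 : 0 < walkConst α τ := by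
      by_contra h
      nlinarith
    nlinarith
  induction w with
  | @nil p =>
    rw [dist_self, zero_add]
    have : (((SimpleGraph.Walk.nil : X.graph.Walk p p).length : ℝ) - p.height - p.height) / 2 =
        -(p.height : ℝ) := by
      simp
      ring
    rw [this]
    exact mul_le_mul_of_nonneg_right hKB (Real.rpow_pos_of_pos hα0 _).le
  | @cons p p' q e w ih =>
    rw [SimpleGraph.Walk.length_cons]
    push_cast
    obtain ⟨-, hh, z, hz, hz'⟩ := e
    rw [Metric.mem_ball] at hz hz'
    rw [← Real.rpow_intCast] at hz hz'
    push_cast at hz hz'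
    have htri : dist p.proj q.proj ≤ τ * α ^ (-(p.height : ℝ)) + τ * α ^ (-(p'.height : ℝ)) +
        dist p'.proj q.proj := by
      have h2 := dist_triangle p.proj z p'.proj
      have h3 := dist_triangle p.proj p'.proj q.proj
      rw [dist_comm p.proj z] at h2
      linarith
    have hlen : (q.height : ℝ) - p.height ≤ w.length + 1 := by
      have h3 := (abs_le.1 (X.abs_height_sub_le_length w)).1
      have h4 : |(p.height : ℝ) - p'.height| ≤ 1 := by exact_mod_cast hh
      linarith [(abs_le.1 h4).1]
    set P : ℝ := α ^ (-(p.height : ℝ)) with hP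
    set E : ℝ := α ^ (((w.length : ℝ) + 1 - p.height - q.height) / 2) with hE
    have hP0 : 0 < P := Real.rpow_pos_of_pos hα0 _
    have hPE : P ≤ E := by
      refine Real.rpow_le_rpow_of_exponent_le hα.le ?_
      linarith
    have hKE : (τ * (1 + α) + heightConst α τ) * P ≤ walkConst α τ * (1 - r) * E := by
      rw [hK]
      exact mul_le_mul_of_nonneg_left hPE (by linarith)
    have hBP : heightConst α τ * (α - 1) * P = τ * (1 + α) * P := by rw [hBα]
    have hαP : τ * P ≤ τ * (α * P) :=
      mul_le_mul_of_nonneg_left (le_mul_of_one_le_left hP0.le hα.le) (by linarith)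
    have hBP0 : 0 ≤ heightConst α τ * P := by positivity
    have hcase : p'.height = p.height - 1 ∨ p'.height = p.height ∨ p'.height = p.height + 1 := by
      have := abs_le.1 hh
      omega
    -- a descending edge leaves `E` as it is and is paid for by `B`; the other edges shrink `E` by at
    -- least the factor `r`, and the definition of `K` pays for them
    rcases hcase with hc | hc | hc
    · have e1 : α ^ (-(p'.height : ℝ)) = α * P := by
        rw [hP, mul_comm, ← Real.rpow_add_one hα0.ne', hc]
        congr 1
        push_cast
        ring
      have e2 : α ^ (((w.length : ℝ) - p'.height - q.height) / 2) = E := by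
        rw [hE, hc]
        congr 1
        push_cast
        ring
      rw [e1, e2] at ih
      rw [e1] at htri
      linarith
    · have e1 : α ^ (-(p'.height : ℝ)) = P := by rw [hc]
      have e2 : α ^ (((w.length : ℝ) - p'.height - q.height) / 2) = E * r := by
        rw [hE, hr, ← Real.rpow_add hα0, hc]
        congr 1
        ring
      rw [e1, e2] at ih
      rw [e1] at htri
      linarith
    · have e1 : α ^ (-(p'.height : ℝ)) = r * r * P := by
        rw [hP, hr, ← Real.rpow_add hα0, ← Real.rpow_add hα0, hc]
        congr 1
        push_cast
        ring
      have e2 : α ^ (((w.length : ℝ) - p'.height - q.height) / 2) = E * (r * r) := by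
        rw [hE, hr, ← Real.rpow_add hα0, ← Real.rpow_add hα0, hc]
        congr 1
        push_cast
        ring
      rw [e1, e2] at ih
      rw [e1] at htri
      have hE0 : 0 < E := hP0.trans_le hPE
      have hK0 : 0 < walkConst α τ := hB.trans_le hKB
      have s1 : walkConst α τ * (E * (r * r)) ≤ walkConst α τ * (E * r) := by
        refine mul_le_mul_of_nonneg_left (mul_le_mul_of_nonneg_left ?_ hE0.le) hK0.le
        nlinarith
      have s2 : τ * (r * r * P) ≤ τ * (α * P) := by
        refine mul_le_mul_of_nonneg_left (mul_le_mul_of_nonneg_right ?_ hP0.le) (by linarith)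
        nlinarith
      have s3 : 0 ≤ heightConst α τ * (r * r * P) := by positivity
      linarith

theorem walkConst_pos (X : HyperbolicFilling Z α τ) : 0 < walkConst α τ := by
  have hα := X.one_lt
  have hα0 := X.pos_base
  have hτ := X.three_lt
  have hr1 : α ^ (-(1 / 2) : ℝ) < 1 := Real.rpow_lt_one_of_one_lt_of_neg hα (by norm_num)
  have h1 : 0 < α - 1 := by linarith
  have h2 : 0 < 1 - α ^ (-(1 / 2) : ℝ) := by linarith
  rw [walkConst, heightConst]
  positivity

/-- The logarithmic constant in the comparison of the filling with the cone. -/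
noncomputable def coneConst (α τ : ℝ) : ℝ := walkConst α τ + τ + 1

/-- The displacement of the anchors of two vertical lines is controlled by the distance of points
on these lines. -/
theorem dist_anchor_add_le {x y : Z} {γ δ : ℝ → X.Space} (hγ : X.IsAnchoredLine x γ)
    (hδ : X.IsAnchoredLine y δ) (u v : ℝ) :
    dist x y + max (α ^ (-u)) (α ^ (-v)) ≤
      coneConst α τ * α ^ ((dist (γ u) (δ v) + 4 - u - v) / 2) := by
  have hα := X.one_lt
  have hα0 := X.pos_base
  have hτ := X.three_lt
  -- passing to the vertices below costs `1` at each point, in length and again in height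
  obtain ⟨p, hp, hpn, hpd⟩ := hγ.exists_vertex ⌊u⌋
  obtain ⟨q, hq, hqn, hqd⟩ := hδ.exists_vertex ⌊v⌋
  rw [← Real.rpow_intCast] at hpd hqd
  push_cast at hpd hqd
  obtain ⟨w, hw⟩ := (X.preconnected p q).exists_walk_length_eq_dist
  have hwalk := X.dist_proj_add_le w
  have hfu := Int.floor_le u
  have hfu' := Int.lt_floor_add_one u
  have hfv := Int.floor_le v
  have hfv' := Int.lt_floor_add_one v
  have hlen : (w.length : ℝ) ≤ dist (γ u) (δ v) + 2 := by
    rw [hw]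
    refine (natDist_le_pathDist X.preconnected p q).trans ?_
    change dist (X.point p) (X.point q) ≤ _
    rw [← hp, ← hq]
    have h1 := dist_triangle4 (γ ⌊u⌋) (γ u) (δ v) (δ ⌊v⌋)
    rw [hγ.isometry.dist_eq, hδ.isometry.dist_eq, Real.dist_eq, Real.dist_eq, abs_sub_comm,
      abs_of_nonneg (sub_nonneg.2 hfu), abs_of_nonneg (sub_nonneg.2 hfv)] at h1
    linarith
  have hh := abs_le.1 (X.abs_height_sub_le (γ u) (δ v))
  rw [hγ.height_eq, hδ.height_eq] at hh
  set D := dist (γ u) (δ v)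
  set E := α ^ ((D + 4 - u - v) / 2) with hE
  have hE0 : 0 < E := Real.rpow_pos_of_pos hα0 _
  have hmono : ∀ {a : ℝ}, a ≤ (D + 4 - u - v) / 2 → α ^ a ≤ E := fun h =>
    Real.rpow_le_rpow_of_exponent_le hα.le h
  have h1 : α ^ (((w.length : ℝ) - p.height - q.height) / 2) ≤ E := by
    refine hmono ?_
    rw [hpn, hqn]
    linarith
  have h2 : α ^ (-(⌊u⌋ : ℝ)) ≤ E := hmono (by linarith [hh.1])
  have h3 : α ^ (-(⌊v⌋ : ℝ)) ≤ E := hmono (by linarith [hh.2])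
  have h4 : max (α ^ (-u)) (α ^ (-v)) ≤ E :=
    max_le (hmono (by linarith [hh.1])) (hmono (by linarith [hh.2]))
  have h5 : 0 ≤ heightConst α τ * α ^ (-(p.height : ℝ)) := by
    rw [heightConst]
    have : 0 < α - 1 := by linarith
    positivity
  have h6 := dist_triangle4 x p.proj q.proj y
  rw [dist_comm q.proj y] at h6
  have h7 := mul_le_mul_of_nonneg_left h1 X.walkConst_pos.le
  have h8 : τ / 3 * α ^ (-(⌊u⌋ : ℝ)) ≤ τ / 3 * E := by gcongr
  have h9 : τ / 3 * α ^ (-(⌊v⌋ : ℝ)) ≤ τ / 3 * E := by gcongr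
  rw [coneConst]
  nlinarith

/-- Two lines can be joined by one edge at every height `n` with `d(x, y) ≤ α⁻ⁿ`. -/
theorem dist_le_of_common_level {x y : Z} {γ δ : ℝ → X.Space} (hγ : X.IsAnchoredLine x γ)
    (hδ : X.IsAnchoredLine y δ) {u v : ℝ} {n : ℤ} (hu : n ≤ u) (hv : n ≤ v)
    (hxy : dist x y ≤ α ^ (-n)) : dist (γ u) (δ v) ≤ u + v - 2 * n + 1 := by
  obtain ⟨p, hp, hpn, hpd⟩ := hγ.exists_vertex n
  obtain ⟨q, hq, hqn, hqd⟩ := hδ.exists_vertex n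
  have hτ := X.three_lt
  have hpos := zpow_pos X.pos_base (-n)
  have h1 : dist (γ n) (δ n) ≤ 1 := by
    rw [hp, hq]
    refine X.dist_point_le_one x (by rw [hpn, hqn]; simp) ?_ ?_
    · rw [hpn]
      nlinarith
    · rw [hqn]
      have := dist_triangle x y q.proj
      nlinarith
  have h2 := dist_triangle4 (γ u) (γ n) (δ n) (δ v)
  rw [hγ.isometry.dist_eq, hδ.isometry.dist_eq, Real.dist_eq, Real.dist_eq, abs_sub_comm _ v,
      abs_of_nonneg (sub_nonneg.2 hu), abs_of_nonneg (sub_nonneg.2 hv)] at h2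
  linarith

/-- The additive constant of the rough similarity between the cone and the filling. -/
noncomputable def simConst (α τ : ℝ) : ℝ :=
  max 4 (2 * Real.log (coneConst α τ) / Real.log α + 4)

theorem isRoughSimilarity_coneToFilling {γ : Z → ℝ → X.Space}
    (hγ : ∀ z, X.IsAnchoredLine z (γ z)) :
    IsRoughSimilarity (1 / Real.log α) (simConst α τ) (coneToFilling X γ) := by
  have hα := X.one_lt
  have hα0 := X.pos_base
  have hτ := X.three_lt
  have hlog : 0 < Real.log α := Real.log_pos hα
  have h4 : 4 ≤ simConst α τ := le_max_left _ _
  have hlevel : ∀ s : ℝ, 0 < s → α ^ (-(-(Real.log s / Real.log α))) = s := fun s hs => by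
    rw [neg_neg, Real.rpow_def_of_pos hα0, mul_div_cancel₀ _ hlog.ne', Real.exp_log hs]
  refine ⟨by positivity, le_rfl, by linarith, fun x => ?_, fun p q => ?_, fun p q => ?_⟩
  · obtain ⟨v, hv⟩ := exists_pathDist_vertex_le_one X.preconnected x
    obtain ⟨q, hq, hqn, hqd⟩ := (hγ v.proj).exists_vertex v.height
    have hpos := zpow_pos X.pos_base (-v.height)
    have h1 : dist (X.point v) (X.point q) ≤ 1 := by
      refine X.dist_point_le_one v.proj (by rw [hqn]; simp) ?_ ?_
      · rw [dist_self]
        positivity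
      · rw [hqn]
        nlinarith
    have h2 : coneToFilling X γ ⟨v.proj, α ^ (-(v.height : ℝ)), Real.rpow_pos_of_pos hα0 _⟩ =
        X.point q := by
      rw [← hq, coneToFilling]
      simp only
      rw [Real.log_rpow hα0, neg_mul, neg_div, neg_neg, mul_div_cancel_right₀ _ hlog.ne']
    have hmem : X.point q ∈ Set.range (coneToFilling X γ) := ⟨_, h2⟩
    refine (Metric.infEDist_le_edist_of_mem hmem).trans ?_
    rw [edist_dist]
    refine ENNReal.ofReal_le_ofReal ?_
    have h3 := dist_triangle x (X.point v) (X.point q)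
    have hv' : dist x (X.point v) ≤ 1 := hv
    linarith
  · have h := X.dist_anchor_add_le (hγ p.base) (hγ q.base) (-(Real.log p.level / Real.log α))
      (-(Real.log q.level / Real.log α))
    rw [hlevel _ p.level_pos, hlevel _ q.level_pos] at h
    change 1 / Real.log α * HypCone.rho p q - _ ≤ dist (coneToFilling X γ p) (coneToFilling X γ q)
    change _ ≤ _ * α ^ ((dist (coneToFilling X γ p) (coneToFilling X γ q) + 4 - _ - _) / 2) at h
    rw [HypCone.rho_eq]
    set D := dist (coneToFilling X γ p) (coneToFilling X γ q)
    have hm : 0 < dist p.base q.base + max p.level q.level :=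
      add_pos_of_nonneg_of_pos dist_nonneg (lt_max_of_lt_left p.level_pos)
    have hc : 0 < coneConst α τ := by
      rw [coneConst]
      linarith [X.walkConst_pos]
    have h' := Real.log_le_log hm h
    rw [Real.log_mul hc.ne' (Real.rpow_pos_of_pos hα0 _).ne', Real.log_rpow hα0] at h'
    have h5 : 2 * Real.log (coneConst α τ) / Real.log α + 4 ≤ simConst α τ := le_max_right _ _
    have h6 : 1 / Real.log α * (2 * Real.log (dist p.base q.base + max p.level q.level) -
        Real.log p.level - Real.log q.level) ≤
        2 * Real.log (coneConst α τ) / Real.log α + 4 + D := by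
      rw [one_div_mul_eq_div, div_le_iff₀ hlog]
      have e1 : (2 * Real.log (coneConst α τ) / Real.log α + 4 + D) * Real.log α =
          2 * Real.log (coneConst α τ) + (4 + D) * Real.log α := by
        field_simp
        ring
      have e2 : (D + 4 - -(Real.log p.level / Real.log α) - -(Real.log q.level / Real.log α)) / 2 *
          Real.log α = ((4 + D) * Real.log α + Real.log p.level + Real.log q.level) / 2 := by
        field_simp
        ring
      rw [e1]
      rw [e2] at h'
      linarith
    linarith
  · change dist (coneToFilling X γ p) (coneToFilling X γ q) ≤
      1 / Real.log α * HypCone.rho p q + _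
    rw [HypCone.rho_eq]
    set M := dist p.base q.base + max p.level q.level
    have hm : 0 < M :=
      add_pos_of_nonneg_of_pos dist_nonneg (lt_max_of_lt_left p.level_pos)
    set m : ℝ := -(Real.log M / Real.log α) with hmdef
    have hd0 : (0 : ℝ) ≤ dist p.base q.base := dist_nonneg
    have hle : ∀ s : ℝ, 0 < s → s ≤ M → m ≤ -(Real.log s / Real.log α) := fun s hs hsM => by
      have := Real.log_le_log hs hsM
      rw [hmdef]
      gcongr
    have hp := hle _ p.level_pos ((le_max_left _ q.level).trans (by linarith))
    have hq := hle _ q.level_pos ((le_max_right p.level _).trans (by linarith))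
    have hf := Int.floor_le m
    have hf' := Int.lt_floor_add_one m
    have h := X.dist_le_of_common_level (hγ p.base) (hγ q.base) (n := ⌊m⌋) (hf.trans hp)
      (hf.trans hq) (by
        have e : dist p.base q.base ≤ M := le_add_of_nonneg_right
          (p.level_pos.le.trans (le_max_left _ _))
        refine e.trans ?_
        rw [← hlevel M hm, ← Real.rpow_intCast]
        refine Real.rpow_le_rpow_of_exponent_le hα.le ?_
        push_cast
        linarith)
    refine h.trans ?_
    have e : 1 / Real.log α * (2 * Real.log M - Real.log p.level - Real.log q.level) =
      -(Real.log p.level / Real.log α) + -(Real.log q.level / Real.log α) - 2 * m := by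
      rw [hmdef]
      field_simp
      ring
    rw [e]
    linarith

end HyperbolicFilling

/-! ### Scale functions -/

/-- The sublinear increasing function with slopes `1/θ` on the left and `θ` on the right of `0`. -/
noncomputable def slopeGauge (θ x : ℝ) : ℝ := max (θ * x) (x / θ)

section SlopeGauge

variable {θ : ℝ}

theorem slopeGauge_of_nonneg (hθ : 1 ≤ θ) {x : ℝ} (hx : 0 ≤ x) : slopeGauge θ x = θ * x := by
  refine max_eq_left ((div_le_self hx hθ).trans ?_)
  nlinarith

theorem slopeGauge_of_nonpos (hθ : 1 ≤ θ) {x : ℝ} (hx : x ≤ 0) : slopeGauge θ x = x / θ := by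
  refine max_eq_right ?_
  rw [le_div_iff₀ (by linarith)]
  nlinarith [mul_nonneg (sub_nonneg.2 hθ) (by linarith : 0 ≤ 1 + θ)]

theorem slopeGauge_add_le (x y : ℝ) :
    slopeGauge θ (x + y) ≤ slopeGauge θ x + slopeGauge θ y := by
  refine max_le ?_ ?_
  · rw [mul_add]
    exact add_le_add (le_max_left _ _) (le_max_left _ _)
  · rw [add_div]
    exact add_le_add (le_max_right _ _) (le_max_right _ _)

theorem slopeGauge_mono (hθ : 1 ≤ θ) : Monotone (slopeGauge θ) := fun x y h =>
  max_le_max (mul_le_mul_of_nonneg_left h (by linarith)) (div_le_div_of_nonneg_right h (by linarith))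

end SlopeGauge

namespace IsPowerQuasiSymmetric

variable {Z : Type u} {W : Type v} [MetricSpace Z] [MetricSpace W] {θ lam : ℝ} {f : Z → W}

/-- Power quasi-symmetry in logarithmic coordinates. -/
theorem logb_dist_sub_le (hf : IsPowerQuasiSymmetric θ lam f) {x y z : Z} (hx : x ≠ z)
    (hy : y ≠ z) :
    Real.logb 2 (dist (f x) (f z)) - Real.logb 2 (dist (f y) (f z)) ≤
      slopeGauge θ (Real.logb 2 (dist x z) - Real.logb 2 (dist y z)) + Real.logb 2 lam := by
  have hθ := hf.one_le_exponent
  have hl : 0 < lam := by linarith [hf.one_le_const]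
  have h1 : 0 < dist x z := dist_pos.2 hx
  have h2 : 0 < dist y z := dist_pos.2 hy
  have h3 : 0 < dist (f x) (f z) := dist_pos.2 (hf.isHomeomorph.injective.ne hx)
  have h4 : 0 < dist (f y) (f z) := dist_pos.2 (hf.isHomeomorph.injective.ne hy)
  have ht : 0 < dist x z / dist y z := div_pos h1 h2
  have h := Real.logb_le_logb_of_le (b := 2) one_lt_two (div_pos h3 h4) (hf.ratio_le x y z hy)
  rw [Real.logb_div h3.ne' h4.ne'] at h
  rw [← Real.logb_div h1.ne' h2.ne']
  refine h.trans ?_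
  rw [powerGauge, slopeGauge]
  split_ifs
  · rw [Real.logb_mul hl.ne' (Real.rpow_pos_of_pos ht _).ne', Real.logb_rpow_eq_mul_logb_of_pos ht,
      one_div_mul_eq_div, add_comm]
    gcongr
    exact le_max_right _ _
  · rw [Real.logb_mul hl.ne' (Real.rpow_pos_of_pos ht _).ne', Real.logb_rpow_eq_mul_logb_of_pos ht,
      add_comm]
    gcongr
    exact le_max_left _ _

end IsPowerQuasiSymmetric

section ScaleFamily

variable {Z : Type u} {W : Type v} [MetricSpace Z] [MetricSpace W]

/-- The scale `-log₂ d(x, y)` of a pair of points. -/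
noncomputable def pairScale (x y : Z) : ℝ := -Real.logb 2 (dist x y)

theorem pairScale_comm (x y : Z) : pairScale x y = pairScale y x := by
  rw [pairScale, pairScale, dist_comm]

/-- The upper bound for the image of the scale `s` at `z` which is given by the point `y`. -/
noncomputable def scaleBound (θ : ℝ) (f : Z → W) (z y : Z) (s : ℝ) : ℝ :=
  pairScale (f z) (f y) + slopeGauge θ (s - pairScale z y)

open Classical in
/-- The scale function of `f` at `z`: the infimum of the bounds `scaleBound θ f z y` over `y ≠ z`,
in the manner of McShane's extension of Lipschitz functions. If `z` is the only point, there is no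
bound, and the identity is taken instead. -/
noncomputable def scaleMap (θ : ℝ) (f : Z → W) (z : Z) (s : ℝ) : ℝ :=
  if Nonempty {y : Z // y ≠ z} then ⨅ y : {y : Z // y ≠ z}, scaleBound θ f z y s else s

/-- The additive constant of the scale functions. -/
noncomputable def scaleConst (θ lam : ℝ) : ℝ := Real.logb 2 lam + 2 * θ

variable {θ lam : ℝ} {f : Z → W}

theorem scaleBound_le_add (y z : Z) (s t : ℝ) :
    scaleBound θ f z y s ≤ scaleBound θ f z y t + slopeGauge θ (s - t) := by
  have := slopeGauge_add_le (θ := θ) (t - pairScale z y) (s - t)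
  rw [sub_add_sub_cancel'] at this
  rw [scaleBound, scaleBound]
  linarith

namespace IsPowerQuasiSymmetric

theorem pairScale_sub_le (hf : IsPowerQuasiSymmetric θ lam f) {z x y : Z} (hx : x ≠ z)
    (hy : y ≠ z) : pairScale (f z) (f y) - pairScale (f z) (f x) ≤
      slopeGauge θ (pairScale z y - pairScale z x) + Real.logb 2 lam := by
  have := hf.logb_dist_sub_le hx hy
  simp only [pairScale]
  rw [dist_comm z y, dist_comm z x, dist_comm (f z), dist_comm (f z)]
  rw [neg_sub_neg, neg_sub_neg]
  exact this

theorem bddBelow_scaleBound (hf : IsPowerQuasiSymmetric θ lam f) (z : Z) (s : ℝ) :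
    BddBelow (Set.range fun y : {y : Z // y ≠ z} => scaleBound θ f z y s) := by
  by_cases h : Nonempty {y : Z // y ≠ z}
  · obtain ⟨x, hx⟩ := h
    refine ⟨pairScale (f z) (f x) - Real.logb 2 lam - slopeGauge θ (pairScale z x - s), ?_⟩
    rintro _ ⟨⟨y, hy⟩, rfl⟩
    have h1 := hf.pairScale_sub_le hy hx
    have h2 := slopeGauge_add_le (θ := θ) (pairScale z x - s) (s - pairScale z y)
    rw [sub_add_sub_cancel] at h2
    simp only [scaleBound]
    linarith
  · refine ⟨0, ?_⟩
    rintro _ ⟨y, rfl⟩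
    exact absurd ⟨y⟩ h

theorem scaleMap_le (hf : IsPowerQuasiSymmetric θ lam f) {z y : Z} (hy : y ≠ z) (s : ℝ) :
    scaleMap θ f z s ≤ scaleBound θ f z y s := by
  rw [scaleMap, if_pos ⟨⟨y, hy⟩⟩]
  exact ciInf_le (hf.bddBelow_scaleBound z s) (⟨y, hy⟩ : {y : Z // y ≠ z})

theorem le_scaleMap {z y : Z} (hy : y ≠ z) {s b : ℝ}
    (hb : ∀ w, w ≠ z → b ≤ scaleBound θ f z w s) : b ≤ scaleMap θ f z s := by
  have : Nonempty {y : Z // y ≠ z} := ⟨⟨y, hy⟩⟩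
  rw [scaleMap, if_pos this]
  exact le_ciInf fun w => hb w w.2

/-- The scale functions are increasing and bi-Lipschitz with constants `1/θ` and `θ`: this bound
contains both estimates, as `slopeGauge θ` has slope `θ` on the right and `1/θ` on the left. -/
theorem scaleMap_sub_le (hf : IsPowerQuasiSymmetric θ lam f) (z : Z) (s t : ℝ) :
    scaleMap θ f z s - scaleMap θ f z t ≤ slopeGauge θ (s - t) := by
  by_cases h : Nonempty {y : Z // y ≠ z}
  · obtain ⟨y, hy⟩ := h
    have : scaleMap θ f z s - slopeGauge θ (s - t) ≤ scaleMap θ f z t :=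
      le_scaleMap hy fun w hw => by
        linarith [hf.scaleMap_le hw s, scaleBound_le_add (θ := θ) (f := f) w z s t]
    linarith
  · rw [scaleMap, scaleMap, if_neg h, if_neg h]
    have hθ := hf.one_le_exponent
    rcases le_total 0 (s - t) with h | h
    · rw [slopeGauge_of_nonneg hθ h]
      nlinarith
    · rw [slopeGauge_of_nonpos hθ h, le_div_iff₀ (by linarith)]
      nlinarith

theorem scaleMap_sub_le_mul (hf : IsPowerQuasiSymmetric θ lam f) (z : Z) {s t : ℝ} (h : s ≤ t) :
    scaleMap θ f z t - scaleMap θ f z s ≤ θ * (t - s) := by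
  have := hf.scaleMap_sub_le z t s
  rwa [slopeGauge_of_nonneg hf.one_le_exponent (by linarith)] at this

theorem div_le_scaleMap_sub (hf : IsPowerQuasiSymmetric θ lam f) (z : Z) {s t : ℝ} (h : s ≤ t) :
    (t - s) / θ ≤ scaleMap θ f z t - scaleMap θ f z s := by
  have := hf.scaleMap_sub_le z s t
  rw [slopeGauge_of_nonpos hf.one_le_exponent (by linarith), ← neg_sub t s, neg_div] at this
  linarith

theorem scaleMap_monotone (hf : IsPowerQuasiSymmetric θ lam f) (z : Z) :
    Monotone (scaleMap θ f z) := fun s t h => by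
  have h1 := hf.div_le_scaleMap_sub z h
  have h2 : 0 ≤ (t - s) / θ :=
    div_nonneg (by linarith) (by linarith [hf.one_le_exponent])
  linarith

theorem abs_scale_sub_le (hf : IsPowerQuasiSymmetric θ lam f) {z y : Z} (h : y ≠ z) :
    |pairScale (f z) (f y) - scaleMap θ f z (pairScale z y)| ≤ Real.logb 2 lam := by
  have h0 : 0 ≤ Real.logb 2 lam := Real.logb_nonneg one_lt_two hf.one_le_const
  have h1 := hf.scaleMap_le h (pairScale z y)
  have h2 : pairScale (f z) (f y) - Real.logb 2 lam ≤ scaleMap θ f z (pairScale z y) :=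
    le_scaleMap h fun w hw => by
      have := hf.pairScale_sub_le hw h
      rw [scaleBound]
      linarith
  rw [scaleBound, sub_self, slopeGauge] at h1
  simp only [mul_zero, zero_div, max_self, add_zero] at h1
  rw [abs_le]
  constructor <;> linarith

/-- At scales at least as coarse as that of the pair `x`, `y`, the scale functions agree up to an
additive constant: a point which is far from the pair, compared with `d(x, y)`, gives about the same
bound at `x` and at `y`, and no point near the pair gives a much better bound than the pair does. -/
theorem scaleMap_le_add (hf : IsPowerQuasiSymmetric θ lam f) {x y : Z} (hxy : x ≠ y) {s : ℝ}
    (hs : s ≤ pairScale x y) :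
    scaleMap θ f y s ≤ scaleMap θ f x s + scaleConst θ lam := by
  have hθ := hf.one_le_exponent
  have hd : 0 < dist x y := dist_pos.2 hxy
  rw [scaleConst]
  suffices h : scaleMap θ f y s - (Real.logb 2 lam + 2 * θ) ≤ scaleMap θ f x s by linarith
  refine le_scaleMap hxy.symm fun w hw => ?_
  have hdw : 0 < dist x w := dist_pos.2 hw.symm
  by_cases hfar : 2 * dist x y ≤ dist x w
  · have hwy : w ≠ y := by
      rintro rfl
      linarith
    have hyw : 0 < dist y w := dist_pos.2 hwy.symm
    have t1 := dist_triangle x y w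
    have t2 := dist_triangle y x w
    rw [dist_comm y x] at t2
    have e1 : pairScale y w ≤ pairScale x w + 1 := by
      have := Real.logb_le_logb_of_le (b := 2) one_lt_two hdw
        (by linarith : dist x w ≤ dist y w * 2)
      rw [Real.logb_mul hyw.ne' two_ne_zero, Real.logb_self_eq_one one_lt_two] at this
      rw [pairScale, pairScale]
      linarith
    have e2 : pairScale x w ≤ pairScale y w + 1 := by
      have := Real.logb_le_logb_of_le (b := 2) one_lt_two hyw
        (by linarith : dist y w ≤ dist x w * 2)
      rw [Real.logb_mul hdw.ne' two_ne_zero, Real.logb_self_eq_one one_lt_two] at this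
      rw [pairScale, pairScale]
      linarith
    -- quasi-symmetry at the far point `w`
    have e3 := hf.pairScale_sub_le hw.symm hwy.symm
    rw [pairScale_comm w y, pairScale_comm w x, pairScale_comm (f w), pairScale_comm (f w)] at e3
    have e4 : slopeGauge θ (pairScale y w - pairScale x w) ≤ θ := by
      refine (slopeGauge_mono hθ (by linarith : _ ≤ (1 : ℝ))).trans ?_
      rw [slopeGauge_of_nonneg hθ zero_le_one, mul_one]
    have e5 : slopeGauge θ (s - pairScale y w) ≤ slopeGauge θ (s - pairScale x w) + θ := by
      refine (slopeGauge_mono hθ (by linarith : _ ≤ s - pairScale x w + 1)).trans ?_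
      refine (slopeGauge_add_le _ _).trans ?_
      rw [slopeGauge_of_nonneg hθ zero_le_one, mul_one]
    have e6 := hf.scaleMap_le hwy s
    simp only [scaleBound] at e6 ⊢
    linarith
  · have e1 : pairScale x y ≤ pairScale x w + 1 := by
      push Not at hfar
      have := Real.logb_le_logb_of_le (b := 2) one_lt_two hdw
        (by linarith : dist x w ≤ dist x y * 2)
      rw [Real.logb_mul hd.ne' two_ne_zero, Real.logb_self_eq_one one_lt_two] at this
      rw [pairScale, pairScale]
      linarith
    have e2 := hf.scaleMap_le hxy s
    have e3 := hf.pairScale_sub_le hw hxy.symm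
    simp only [scaleBound] at e2 ⊢
    rw [pairScale_comm (f y), pairScale_comm y] at e2
    rw [slopeGauge_of_nonpos hθ (by linarith : s - pairScale x y ≤ 0)] at e2
    have e4 : slopeGauge θ (pairScale x y - pairScale x w) ≤
        (pairScale x y - pairScale x w) / θ + θ := by
      rcases le_total (pairScale x y) (pairScale x w) with h | h
      · rw [slopeGauge_of_nonpos hθ (by linarith)]
        linarith
      · rw [slopeGauge_of_nonneg hθ (by linarith)]
        have : 0 ≤ (pairScale x y - pairScale x w) / θ :=
          div_nonneg (by linarith) (by linarith)
        nlinarith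
    have e5 : (s - pairScale x w) / θ ≤ slopeGauge θ (s - pairScale x w) := le_max_right _ _
    have e6 : (s - pairScale x w) / θ =
        (s - pairScale x y) / θ + (pairScale x y - pairScale x w) / θ := by
      rw [← add_div]
      ring
    linarith

theorem abs_scaleMap_sub_le (hf : IsPowerQuasiSymmetric θ lam f) {x y : Z} (hxy : x ≠ y) {s : ℝ}
    (hs : s ≤ pairScale x y) : |scaleMap θ f x s - scaleMap θ f y s| ≤ scaleConst θ lam := by
  have h1 := hf.scaleMap_le_add hxy hs
  have h2 := hf.scaleMap_le_add hxy.symm (hs.trans_eq (pairScale_comm x y))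
  rw [abs_le]
  constructor <;> linarith

theorem dist_scaleMap_le (hf : IsPowerQuasiSymmetric θ lam f) (z : Z) (s t : ℝ) :
    dist (scaleMap θ f z s) (scaleMap θ f z t) ≤ θ * dist s t := by
  rcases le_total s t with h | h
  · rw [dist_comm, dist_comm s, Real.dist_eq, Real.dist_eq, abs_of_nonneg (sub_nonneg.2 h),
      abs_of_nonneg (sub_nonneg.2 (hf.scaleMap_monotone z h))]
    exact hf.scaleMap_sub_le_mul z h
  · rw [Real.dist_eq, Real.dist_eq, abs_of_nonneg (sub_nonneg.2 h),
      abs_of_nonneg (sub_nonneg.2 (hf.scaleMap_monotone z h))]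
    exact hf.scaleMap_sub_le_mul z h

theorem le_dist_scaleMap (hf : IsPowerQuasiSymmetric θ lam f) (z : Z) (s t : ℝ) :
    1 / θ * dist s t ≤ dist (scaleMap θ f z s) (scaleMap θ f z t) := by
  rw [one_div_mul_eq_div]
  rcases le_total s t with h | h
  · rw [dist_comm s, dist_comm (scaleMap θ f z s), Real.dist_eq, Real.dist_eq,
      abs_of_nonneg (sub_nonneg.2 h), abs_of_nonneg (sub_nonneg.2 (hf.scaleMap_monotone z h))]
    exact hf.div_le_scaleMap_sub z h
  · rw [Real.dist_eq, Real.dist_eq, abs_of_nonneg (sub_nonneg.2 h),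
      abs_of_nonneg (sub_nonneg.2 (hf.scaleMap_monotone z h))]
    exact hf.div_le_scaleMap_sub z h

theorem isScaleFamily_scaleMap (hf : IsPowerQuasiSymmetric θ lam f) :
    IsScaleFamily θ (scaleConst θ lam) f (scaleMap θ f) := by
  have hθ := hf.one_le_exponent
  have hθ0 : 0 < θ := by linarith
  have hl : 0 ≤ Real.logb 2 lam := Real.logb_nonneg one_lt_two hf.one_le_const
  have hμ : 0 ≤ scaleConst θ lam := by
    rw [scaleConst]
    positivity
  have hcont : ∀ z, Continuous (scaleMap θ f z) := fun z =>
    (LipschitzWith.of_dist_le_mul (K := ⟨θ, hθ0.le⟩) (hf.dist_scaleMap_le z)).continuous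
  have htop : ∀ z, Filter.Tendsto (scaleMap θ f z) Filter.atTop Filter.atTop := fun z => by
    refine Filter.tendsto_atTop_mono' _ ?_ (Filter.tendsto_atTop_add_const_right _
      (scaleMap θ f z 0) (Filter.tendsto_id.atTop_div_const hθ0))
    filter_upwards [Filter.eventually_ge_atTop 0] with s hs
    have := hf.div_le_scaleMap_sub z hs
    rw [sub_zero] at this
    simp only [id]
    linarith
  have hbot : ∀ z, Filter.Tendsto (scaleMap θ f z) Filter.atBot Filter.atBot := fun z => by
    refine Filter.tendsto_atBot_mono' _ ?_ (Filter.tendsto_atBot_add_const_right _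
      (scaleMap θ f z 0) (Filter.tendsto_id.atBot_div_const hθ0))
    filter_upwards [Filter.eventually_le_atBot 0] with s hs
    have := hf.div_le_scaleMap_sub z hs
    rw [zero_sub, neg_div] at this
    simp only [id]
    linarith
  have hsurj : ∀ z, Function.Surjective (scaleMap θ f z) := fun z =>
    (hcont z).surjective (htop z) (hbot z)
  refine ⟨hf.scaleMap_monotone, hcont, hbot, htop, hsurj, fun z => ?_, fun z y h => ?_,
    fun x y hxy t ht => ?_⟩
  · refine ⟨by positivity, ?_, hμ, fun y => ?_, fun s t => ?_, fun s t => ?_⟩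
    · rw [div_le_iff₀ hθ0]
      nlinarith
    · rw [(hsurj z).range_eq, Metric.infEDist_zero_of_mem (Set.mem_univ y)]
      exact zero_le
    · linarith [hf.le_dist_scaleMap z s t]
    · linarith [hf.dist_scaleMap_le z s t]
  · refine (hf.abs_scale_sub_le h.symm).trans ?_
    rw [scaleConst]
    linarith
  · have hd : 0 < dist x y := dist_pos.2 hxy
    have hs : -Real.logb 2 t ≤ pairScale x y :=
      neg_le_neg (Real.logb_le_logb_of_le one_lt_two hd ht)
    exact hf.abs_scaleMap_sub_le hxy hs

end IsPowerQuasiSymmetric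

end ScaleFamily

/-! ### The cone map -/

section Cone

/-- The exponent `-log₂` of the level of a point in the cone. -/
noncomputable def HypCone.scale {Z : Type u} (p : HypCone Z) : ℝ := -Real.logb 2 p.level

theorem scale_coneMap {Z : Type u} {W : Type v} (f : Z → W) (Φ : Z → ℝ → ℝ) (p : HypCone Z) :
    (coneMap f Φ p).scale = Φ p.base p.scale := by
  rw [HypCone.scale, coneMap]
  simp only
  rw [Real.logb_rpow two_pos (by norm_num), neg_neg]
  rfl

variable {Z : Type u} {W : Type v} [MetricSpace Z] [MetricSpace W]

theorem HypCone.dist_eq (p q : HypCone Z) : dist p q =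
    Real.log 2 * (2 * Real.logb 2 (dist p.base q.base + max p.level q.level) +
      p.scale + q.scale) := by
  have h : Real.log 2 ≠ 0 := (Real.log_pos one_lt_two).ne'
  refine (HypCone.rho_eq p q).trans ?_
  rw [HypCone.scale, HypCone.scale, Real.logb, Real.logb, Real.logb]
  field_simp
  ring

/-- Two points of the cone over the same base point. -/
theorem HypCone.dist_of_base_eq {p q : HypCone Z} (h : p.base = q.base) :
    dist p q = Real.log 2 * |p.scale - q.scale| := by
  rw [HypCone.dist_eq, h, dist_self, zero_add]
  congr 1
  rcases le_total p.level q.level with hl | hl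
  · have := Real.logb_le_logb_of_le (b := 2) one_lt_two p.level_pos hl
    rw [max_eq_right hl, HypCone.scale, HypCone.scale, abs_of_nonneg (by linarith)]
    ring
  · have := Real.logb_le_logb_of_le (b := 2) one_lt_two q.level_pos hl
    rw [max_eq_left hl, HypCone.scale, HypCone.scale, abs_of_nonpos (by linarith)]
    ring

/-- The coarsest of the scales of two points of the cone and of the pair of their base points. -/
noncomputable def HypCone.meet (p q : HypCone Z) : ℝ :=
  min (pairScale p.base q.base) (min p.scale q.scale)

theorem HypCone.abs_dist_sub_le {p q : HypCone Z} (h : p.base ≠ q.base) :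
    |dist p q - Real.log 2 * (p.scale + q.scale - 2 * HypCone.meet p q)| ≤ 2 * Real.log 2 := by
  have hd : 0 < dist p.base q.base := dist_pos.2 h
  have hm : 0 < max p.level q.level := lt_max_of_lt_left p.level_pos
  have hlog : 0 < Real.log 2 := Real.log_pos one_lt_two
  set M := dist p.base q.base + max p.level q.level with hM
  have hM0 : 0 < M := add_pos hd hm
  have h1 : -Real.logb 2 M ≤ HypCone.meet p q := by
    refine le_min (neg_le_neg ?_) (le_min (neg_le_neg ?_) (neg_le_neg ?_))
    · exact Real.logb_le_logb_of_le one_lt_two hd (by linarith)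
    · exact Real.logb_le_logb_of_le one_lt_two p.level_pos
        (by linarith [le_max_left p.level q.level])
    · exact Real.logb_le_logb_of_le one_lt_two q.level_pos
        (by linarith [le_max_right p.level q.level])
  have h2 : HypCone.meet p q ≤ -Real.logb 2 M + 1 := by
    have key : ∀ r : ℝ, 0 < r → M ≤ r * 2 → -Real.logb 2 r ≤ -Real.logb 2 M + 1 :=
      fun r hr hMr => by
        have := Real.logb_le_logb_of_le (b := 2) one_lt_two hM0 hMr
        rw [Real.logb_mul hr.ne' two_ne_zero, Real.logb_self_eq_one one_lt_two] at this
        linarith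
    rcases le_total (max p.level q.level) (dist p.base q.base) with h | h
    · exact (min_le_left _ _).trans (key _ hd (by linarith))
    · rcases le_total p.level q.level with hl | hl
      · rw [max_eq_right hl] at h hM
        exact (min_le_right _ _).trans ((min_le_right _ _).trans (key _ q.level_pos (by linarith)))
      · rw [max_eq_left hl] at h hM
        exact (min_le_right _ _).trans ((min_le_left _ _).trans (key _ p.level_pos (by linarith)))
  rw [HypCone.dist_eq, ← mul_sub, abs_mul, abs_of_pos hlog, mul_comm _ (Real.log 2)]
  refine mul_le_mul_of_nonneg_left ?_ hlog.le
  rw [abs_le]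
  constructor <;> linarith

/-- The cone map carries the meeting scale of two points to that of their images, by way of the
scale function of the first base point. -/
theorem IsScaleFamily.abs_meet_sub_le {θ μ : ℝ} {f : Z → W} {Φ : Z → ℝ → ℝ}
    (hΦ : IsScaleFamily θ μ f Φ) {p q : HypCone Z} (h : p.base ≠ q.base) :
    |HypCone.meet (coneMap f Φ p) (coneMap f Φ q) - Φ p.base (HypCone.meet p q)| ≤ μ := by
  set m := HypCone.meet p q with hm
  have hma : m ≤ pairScale p.base q.base := min_le_left _ _
  have hmp : m ≤ p.scale := (min_le_right _ _).trans (min_le_left _ _)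
  have hmq : m ≤ q.scale := (min_le_right _ _).trans (min_le_right _ _)
  have hscale := abs_le.1 (hΦ.scale p.base q.base h)
  change -μ ≤ pairScale _ _ - Φ p.base (pairScale _ _) ∧
    pairScale _ _ - Φ p.base (pairScale _ _) ≤ μ at hscale
  have hcomp : |Φ p.base m - Φ q.base m| ≤ μ := by
    have hd : 0 < dist p.base q.base := dist_pos.2 h
    have := hΦ.compare p.base q.base h ((2 : ℝ) ^ (-m)) (by
      rw [← Real.logb_le_iff_le_rpow one_lt_two hd]
      rw [pairScale] at hma
      linarith)
    rwa [Real.logb_rpow two_pos (by norm_num), neg_neg] at this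
  have hcomp' := abs_le.1 hcomp
  have hμ : 0 ≤ μ := (abs_nonneg _).trans hcomp
  have e : HypCone.meet (coneMap f Φ p) (coneMap f Φ q) =
      min (pairScale (f p.base) (f q.base)) (min (Φ p.base p.scale) (Φ q.base q.scale)) := by
    rw [HypCone.meet, scale_coneMap, scale_coneMap]
    rfl
  have m1 := hΦ.monotone p.base hma
  have m2 := hΦ.monotone p.base hmp
  have m3 := hΦ.monotone q.base hmq
  rw [e, abs_le]
  constructor
  · have : Φ p.base m - μ ≤ min (pairScale (f p.base) (f q.base))
        (min (Φ p.base p.scale) (Φ q.base q.scale)) :=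
      le_min (by linarith) (le_min (by linarith) (by linarith))
    linarith
  · rw [sub_le_iff_le_add]
    rcases min_choice (pairScale p.base q.base) (min p.scale q.scale) with h1 | h1
    · refine (min_le_left _ _).trans ?_
      change m = _ at h1
      rw [h1]
      linarith
    · rcases min_choice p.scale q.scale with h2 | h2
      · refine (min_le_right _ _).trans ((min_le_left _ _).trans ?_)
        have h3 : m = p.scale := h1.trans h2
        rw [h3]
        linarith
      · refine (min_le_right _ _).trans ((min_le_right _ _).trans ?_)
        have h3 : m = q.scale := h1.trans h2
        rw [← h3]
        linarith

/-- The additive constant of the cone map. -/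
noncomputable def coneMapConst (θ lam : ℝ) : ℝ := Real.log 2 * (2 + 2 * θ + 3 * scaleConst θ lam)

theorem IsPowerQuasiSymmetric.coneMap_surjective {θ lam : ℝ} {f : Z → W}
    (hf : IsPowerQuasiSymmetric θ lam f) : Function.Surjective (coneMap f (scaleMap θ f)) := by
  intro q
  obtain ⟨z, hz⟩ := hf.isHomeomorph.surjective q.base
  obtain ⟨s, hs⟩ := hf.isScaleFamily_scaleMap.surjective z q.scale
  refine ⟨⟨z, 2 ^ (-s), Real.rpow_pos_of_pos two_pos _⟩, HypCone.ext hz ?_⟩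
  simp only [coneMap]
  rw [Real.logb_rpow two_pos (by norm_num), neg_neg, hs, HypCone.scale, neg_neg,
    Real.rpow_logb two_pos (by norm_num) q.level_pos]

theorem IsPowerQuasiSymmetric.isRoughQuasiIsometry_coneMap {θ lam : ℝ} {f : Z → W}
    (hf : IsPowerQuasiSymmetric θ lam f) :
    IsRoughQuasiIsometry (1 / θ) θ (coneMapConst θ lam) (coneMap f (scaleMap θ f)) := by
  have hθ := hf.one_le_exponent
  have hθ0 : 0 < θ := by linarith
  have hl : 0 ≤ Real.logb 2 lam := Real.logb_nonneg one_lt_two hf.one_le_const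
  have hμ : 0 ≤ scaleConst θ lam := by
    rw [scaleConst]
    positivity
  have hlog : 0 < Real.log 2 := Real.log_pos one_lt_two
  have hk : 0 ≤ coneMapConst θ lam := by
    rw [coneMapConst]
    positivity
  have hθi : 1 / θ ≤ θ := by
    rw [div_le_iff₀ hθ0]
    nlinarith
  have hΦ := hf.isScaleFamily_scaleMap
  have key : ∀ p q : HypCone Z,
      1 / θ * dist p q - coneMapConst θ lam ≤
        dist (coneMap f (scaleMap θ f) p) (coneMap f (scaleMap θ f) q) ∧
      dist (coneMap f (scaleMap θ f) p) (coneMap f (scaleMap θ f) q) ≤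
        θ * dist p q + coneMapConst θ lam := by
    intro p q
    by_cases h : p.base = q.base
    · have h' : (coneMap f (scaleMap θ f) p).base = (coneMap f (scaleMap θ f) q).base :=
        congrArg f h
      rw [HypCone.dist_of_base_eq h, HypCone.dist_of_base_eq h', scale_coneMap, scale_coneMap, ← h]
      have h1 := hf.le_dist_scaleMap p.base p.scale q.scale
      have h2 := hf.dist_scaleMap_le p.base p.scale q.scale
      rw [Real.dist_eq, Real.dist_eq] at h1 h2
      have h3 := mul_le_mul_of_nonneg_left h1 hlog.le
      have h4 := mul_le_mul_of_nonneg_left h2 hlog.le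
      constructor <;> linarith
    · have h' : (coneMap f (scaleMap θ f) p).base ≠ (coneMap f (scaleMap θ f) q).base :=
        hf.isHomeomorph.injective.ne h
      have d1 := abs_le.1 (HypCone.abs_dist_sub_le h)
      have d2 := abs_le.1 (HypCone.abs_dist_sub_le h')
      have hmeet := hΦ.abs_meet_sub_le h
      have hcomp : |scaleMap θ f p.base (HypCone.meet p q) -
          scaleMap θ f q.base (HypCone.meet p q)| ≤ scaleConst θ lam :=
        hf.abs_scaleMap_sub_le h (min_le_left _ _)
      rw [scale_coneMap, scale_coneMap] at d2
      have hmp : HypCone.meet p q ≤ p.scale := (min_le_right _ _).trans (min_le_left _ _)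
      have hmq : HypCone.meet p q ≤ q.scale := (min_le_right _ _).trans (min_le_right _ _)
      have u1 := hf.scaleMap_sub_le_mul p.base hmp
      have u2 := hf.scaleMap_sub_le_mul q.base hmq
      have l1 := hf.div_le_scaleMap_sub p.base hmp
      have l2 := hf.div_le_scaleMap_sub q.base hmq
      have hmeet' := abs_le.1 hmeet
      have hcomp' := abs_le.1 hcomp
      generalize HypCone.meet (coneMap f (scaleMap θ f) p) (coneMap f (scaleMap θ f) q) = M at *
      generalize HypCone.meet p q = m at *
      generalize dist (coneMap f (scaleMap θ f) p) (coneMap f (scaleMap θ f) q) = D' at *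
      generalize dist p q = D at *
      generalize scaleMap θ f p.base p.scale = P at *
      generalize scaleMap θ f q.base q.scale = Q at *
      generalize scaleMap θ f p.base m = A at *
      generalize scaleMap θ f q.base m = B at *
      generalize p.scale = a at *
      generalize q.scale = b at *
      rw [coneMapConst]
      generalize scaleConst θ lam = μ at *
      -- comparison of the two model distances `p + q - 2 m`
      have hup : P + Q - 2 * M ≤ θ * (a + b - 2 * m) + 3 * μ := by linarith
      have hlo : 1 / θ * (a + b - 2 * m) - 3 * μ ≤ P + Q - 2 * M := by
        have : 1 / θ * (a + b - 2 * m) = (a - m) / θ + (b - m) / θ := by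
          field_simp
          ring
        linarith
      have hup' := mul_le_mul_of_nonneg_left hup hlog.le
      have hlo' := mul_le_mul_of_nonneg_left hlo hlog.le
      have hD1 : θ * (Real.log 2 * (a + b - 2 * m)) ≤ θ * (D + 2 * Real.log 2) :=
        mul_le_mul_of_nonneg_left (by linarith) hθ0.le
      have hD2 : 1 / θ * D ≤ 1 / θ * (Real.log 2 * (a + b - 2 * m) + 2 * Real.log 2) :=
        mul_le_mul_of_nonneg_left (by linarith) (by positivity)
      have hD3 : 1 / θ * (2 * Real.log 2) ≤ θ * (2 * Real.log 2) :=
        mul_le_mul_of_nonneg_right hθi (by linarith)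
      constructor <;> linarith
  refine ⟨by positivity, hθi, hk, fun y => ?_, fun p q => (key p q).1, fun p q => (key p q).2⟩
  rw [hf.coneMap_surjective.range_eq, Metric.infEDist_zero_of_mem (Set.mem_univ y)]
  exact zero_le

end Cone

/-! ### Composition and rough sections -/

section Rough

variable {X : Type u} {Y : Type v} {T : Type w} [MetricSpace X] [MetricSpace Y] [MetricSpace T]

theorem IsRoughQuasiIsometry.exists_dist_lt {a₁ a₂ k : ℝ} {f : X → Y}
    (hf : IsRoughQuasiIsometry a₁ a₂ k f) (y : Y) : ∃ x, dist y (f x) < k + 1 := by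
  have h : Metric.infEDist y (Set.range f) < ENNReal.ofReal (k + 1) :=
    (hf.cobounded y).trans_lt
      ((ENNReal.ofReal_lt_ofReal_iff (by linarith [hf.nonneg])).2 (by linarith))
  obtain ⟨_, ⟨x, rfl⟩, hx⟩ := Metric.infEDist_lt_iff.1 h
  rw [edist_dist, ENNReal.ofReal_lt_ofReal_iff (by linarith [hf.nonneg])] at hx
  exact ⟨x, hx⟩

theorem infEDist_range_le {X : Type u} {f : X → Y} {y : Y} {k : ℝ} (x : X) (h : dist y (f x) ≤ k) :
    Metric.infEDist y (Set.range f) ≤ ENNReal.ofReal k := by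
  refine (Metric.infEDist_le_edist_of_mem (Set.mem_range_self x)).trans ?_
  rw [edist_dist]
  exact ENNReal.ofReal_le_ofReal h

/-- Composition of rough quasi-isometric mappings. The summand `1` appears because the points in
the definition of coboundedness need not be attained. -/
theorem IsRoughQuasiIsometry.comp {a₁ a₂ k b₁ b₂ l : ℝ} {f : X → Y} {g : Y → T}
    (hg : IsRoughQuasiIsometry b₁ b₂ l g) (hf : IsRoughQuasiIsometry a₁ a₂ k f) :
    IsRoughQuasiIsometry (b₁ * a₁) (b₂ * a₂) (b₂ * (k + 1) + 2 * l + 1) (g ∘ f) := by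
  have hb2 : 0 < b₂ := hg.pos.trans_le hg.le
  have hk := hf.nonneg
  have hl := hg.nonneg
  have hbk : b₁ * k ≤ b₂ * k := mul_le_mul_of_nonneg_right hg.le hk
  refine ⟨mul_pos hg.pos hf.pos, mul_le_mul hg.le hf.le hf.pos.le hb2.le, by positivity,
    fun t => ?_, fun x z => ?_, fun x z => ?_⟩
  · obtain ⟨y, hy⟩ := hg.exists_dist_lt t
    obtain ⟨x, hx⟩ := hf.exists_dist_lt y
    refine infEDist_range_le x ?_
    have h1 := dist_triangle t (g y) (g (f x))
    have h2 := hg.upper y (f x)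
    have h3 := mul_le_mul_of_nonneg_left hx.le hb2.le
    change dist t (g (f x)) ≤ _
    linarith
  · have h1 := hg.lower (f x) (f z)
    have h2 := mul_le_mul_of_nonneg_left (hf.lower x z) hg.pos.le
    change _ ≤ dist (g (f x)) (g (f z))
    rw [mul_assoc]
    linarith
  · have h1 := hg.upper (f x) (f z)
    have h2 := mul_le_mul_of_nonneg_left (hf.upper x z) hb2.le
    change dist (g (f x)) (g (f z)) ≤ _
    rw [mul_assoc]
    linarith

theorem IsRoughQuasiIsometry.exists_isRoughSection {a₁ a₂ k : ℝ} {f : X → Y}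
    (hf : IsRoughQuasiIsometry a₁ a₂ k f) : ∃ g, IsRoughSection k f g := by
  have h : ∀ y, ∃ x, (y ∈ Set.range f → f x = y) ∧ dist y (f x) ≤ k + 1 := fun y => by
    by_cases hy : y ∈ Set.range f
    · obtain ⟨x, rfl⟩ := hy
      exact ⟨x, fun _ => rfl, by rw [dist_self]; linarith [hf.nonneg]⟩
    · obtain ⟨x, hx⟩ := hf.exists_dist_lt y
      exact ⟨x, fun h => absurd h hy, hx.le⟩
  choose g hg using h
  exact ⟨g, fun y => (hg y).1, fun y => (hg y).2⟩

variable {a k : ℝ} {f : X → Y} {g : Y → X}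

theorem IsRoughSection.dist_comp_le (hg : IsRoughSection k f g) (hf : IsRoughSimilarity a k f)
    (x : X) : dist (g (f x)) x ≤ k / a := by
  have h := hf.lower (g (f x)) x
  rw [hg.1 _ (Set.mem_range_self x), dist_self] at h
  rw [le_div_iff₀ hf.pos]
  linarith

theorem IsRoughSection.isRoughSimilarity (hg : IsRoughSection k f g)
    (hf : IsRoughSimilarity a k f) : IsRoughSimilarity (1 / a) ((3 * k + 2) / a) g := by
  have ha := hf.pos
  have hk := hf.nonneg
  have key : ∀ y z, |dist (f (g y)) (f (g z)) - dist y z| ≤ 2 * (k + 1) := fun y z => by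
    have h1 := hg.2 y
    have h2 := hg.2 z
    have h3 := dist_triangle4 y (f (g y)) (f (g z)) z
    have h5 := dist_triangle4 (f (g y)) y z (f (g z))
    rw [dist_comm (f (g z)) z] at h3
    rw [dist_comm (f (g y)) y] at h5
    rw [abs_le]
    constructor <;> linarith
  refine ⟨by positivity, le_rfl, by positivity, fun x => ?_, fun y z => ?_, fun y z => ?_⟩
  · refine infEDist_range_le (f x) ?_
    rw [dist_comm]
    refine (hg.dist_comp_le hf x).trans ?_
    gcongr
    linarith
  · have h1 := hf.upper (g y) (g z)
    have h2 := (abs_le.1 (key y z)).1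
    rw [one_div_mul_eq_div, ← sub_div, div_le_iff₀ ha]
    linarith
  · have h1 := hf.lower (g y) (g z)
    have h2 := (abs_le.1 (key y z)).2
    rw [one_div_mul_eq_div, ← add_div, le_div_iff₀ ha]
    linarith

theorem IsRoughSection.isRoughInverse (hg : IsRoughSection k f g)
    (hf : IsRoughSimilarity a k f) : IsRoughInverse f g :=
  ⟨⟨_, _, _, hg.isRoughSimilarity hf⟩, ⟨_, hg.dist_comp_le hf⟩, ⟨k + 1, fun y => by
    rw [dist_comm]
    exact hg.2 y⟩⟩

end Rough

/-! ### The extension to the fillings -/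

/-- The additive constant of a rough section of the map from the cone to the filling. -/
noncomputable def sectionConst (α τ : ℝ) : ℝ :=
  (3 * HyperbolicFilling.simConst α τ + 2) / (1 / Real.log α)

/-- The additive constant of the extension to the fillings, as given by composing twice. -/
noncomputable def extensionConst (αZ τZ αW τW θ lam : ℝ) : ℝ :=
  1 / Real.log αW * (θ * (sectionConst αZ τZ + 1) + 2 * coneMapConst θ lam + 1 + 1) +
    2 * HyperbolicFilling.simConst αW τW + 1

theorem theorem4p1 :
    ∃ (Cσ Cι : ℝ → ℝ → ℝ) (μ k : ℝ → ℝ → ℝ) (Λ : ℝ → ℝ → ℝ → ℝ → ℝ → ℝ → ℝ),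
    ∀ (Z : Type u) (W : Type v) [MetricSpace Z] [CompleteSpace Z] [MetricSpace W]
      [CompleteSpace W] (αZ τZ αW τW θ lam : ℝ)
      (XZ : HyperbolicFilling Z αZ τZ) (XW : HyperbolicFilling W αW τW)
      (f : Z → W), IsPowerQuasiSymmetric θ lam f →
      -- anchored vertical lines exist
      (∀ z : Z, ∃ γ : ℝ → XZ.Space, XZ.IsAnchoredLine z γ) ∧
      (∀ w : W, ∃ γ : ℝ → XW.Space, XW.IsAnchoredLine w γ) ∧
      -- the cone extension of `f`
      ∃ Φ : Z → ℝ → ℝ, IsScaleFamily θ (μ θ lam) f Φ ∧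
        IsRoughQuasiIsometry (1 / θ) θ (k θ lam) (coneMap f Φ) ∧
        ∀ (γZ : Z → ℝ → XZ.Space) (γW : W → ℝ → XW.Space),
          (∀ z : Z, XZ.IsAnchoredLine z (γZ z)) → (∀ w : W, XW.IsAnchoredLine w (γW w)) →
          -- the rough similarities between cones and fillings
          IsRoughSimilarity (1 / Real.log αZ) (Cσ αZ τZ) (coneToFilling XZ γZ) ∧
          IsRoughSimilarity (1 / Real.log αW) (Cσ αW τW) (coneToFilling XW γW) ∧
          (∃ ι : XZ.Space → HypCone Z, IsRoughSection (Cσ αZ τZ) (coneToFilling XZ γZ) ι) ∧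
          ∀ ι : XZ.Space → HypCone Z, IsRoughSection (Cσ αZ τZ) (coneToFilling XZ γZ) ι →
            IsRoughInverse (coneToFilling XZ γZ) ι ∧
            IsRoughSimilarity (Real.log αZ) (Cι αZ τZ) ι ∧
            -- the extension of `f` to the fillings
            IsRoughQuasiIsometry (Real.log αZ / (θ * Real.log αW))
              (θ * Real.log αZ / Real.log αW) (Λ αZ τZ αW τW θ lam)
              (coneToFilling XW γW ∘ coneMap f Φ ∘ ι) := by
  refine ⟨HyperbolicFilling.simConst, sectionConst, scaleConst, coneMapConst, extensionConst, ?_⟩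
  intro Z W _ _ _ _ αZ τZ αW τW θ lam XZ XW f hf
  refine ⟨XZ.exists_isAnchoredLine, XW.exists_isAnchoredLine, scaleMap θ f,
    hf.isScaleFamily_scaleMap, hf.isRoughQuasiIsometry_coneMap, fun γZ γW hγZ hγW => ?_⟩
  have hZ := XZ.isRoughSimilarity_coneToFilling hγZ
  have hW := XW.isRoughSimilarity_coneToFilling hγW
  refine ⟨hZ, hW, IsRoughQuasiIsometry.exists_isRoughSection hZ, fun ι hι => ?_⟩
  have hsim : IsRoughSimilarity (Real.log αZ) (sectionConst αZ τZ) ι := by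
    have := hι.isRoughSimilarity hZ
    rwa [one_div_one_div] at this
  refine ⟨hι.isRoughInverse hZ, hsim, ?_⟩
  have h := IsRoughQuasiIsometry.comp hW (hf.isRoughQuasiIsometry_coneMap.comp hsim)
  have e1 : 1 / Real.log αW * (1 / θ * Real.log αZ) = Real.log αZ / (θ * Real.log αW) := by
    rw [← mul_assoc, one_div_mul_one_div, one_div_mul_eq_div, mul_comm θ]
  have e2 : 1 / Real.log αW * (θ * Real.log αZ) = θ * Real.log αZ / Real.log αW :=
    one_div_mul_eq_div _ _
  rw [e1, e2] at h
  exact h
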